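/- Let $n\in\mathbb N$, $T>0$, let $K\subseteq\mathbb R^n$ be a non-empty closed convex cone with vertex at the origin, and let $D\subsetneq\mathbb R^n$ be a non-empty open connected set with closure $\bar D$. Let $f:[0,T]\times\mathbb R^n\to\mathbb R^n$, $g:[0,T]\times\mathbb R^n\to[0,\infty)$, $h:\mathbb R^n\to[0,\infty)$ and $\ell:[0,T]\times\mathbb R^n\times K\to(0,\infty)$ be continuous. Let $L,\mu,\ell_0,\delta_0>0$, $\delta,\beta\in(0,1]$, and let $\alpha_0,\alpha:[0,T]\to(0,\infty)$ be continuous and non-increasing. **Control problem.** For $t\in[0,T]$ and $x\in\mathbb R^n$, an impulse control on $[t,T]$ is a finite (possibly empty) sequence $(\tau_k,\xi_k)_{1\le k\le N}$ with $t\le\tau_1\le\dots\le\tau_N\le T$ and $\xi_k\in K$; put $\xi(s)=\sum_k\xi_k\mathbf 1_{[\tau_k,T]}(s)$. Its state trajectory $X$ on $[t,T]$ solves $$X(s)=x+\int_t^s f(r,X(r))\,dr+\xi(s),\qquad s\in[t,T],$$ with the convention $X(t-0)=x$, and its cost is $$J(t,x;\xi)=\int_t^T g(s,X(s))\,ds+h(X(T))+\sum_{k}\ell\big(\tau_k,\widetilde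 X(\tau_k-0),\xi_k\big),\qquad \widetilde X(\tau_k-0)=X(\tau_k-0)+\sum_{j<k,\ \tau_j=\tau_k}\xi_j .$$ The value function is $V(t,x)=\inf J(t,x;\xi)$ over all impulse controls on $[t,T]$ with $X(T)\in\bar D$ (with $\inf\varnothing=+\infty$). **Hypotheses.** * (H1$'$) Either $D$ is bounded and $K=\mathbb R^n$, or $D$ is conic with vertex at the origin ($\lambda x\in D$ for all $x\in D$, $\lambda>0$) and $D-K=\mathbb R^n$. * (H2) $|f(t,x)-f(t,x')|\le L|x-x'|$ and $|f(t,0)|\le L$ for all $t\in[0,T]$, $x,x'\in\mathbb R^n$. * (H3) $0\le g(t,x),\,h(x)\le L(1+|x|^{\mu+\delta})$, and both $|g(t,x)-g(t,x')|$ and $|h(x)-h(x')|$ are at most $L\big(1+\max(|x|^\mu,|x'|^\mu)\big)|x-x'|^\delta$, for all $t\in[0,T]$, $x,x'\in\mathbb R^n$. * (H4) For all $t,t'\in[0,T]$ with $t\le t'$, all $x,x'\in\mathbb R^n$ and all $\xi,\xi'\in K$: $\ \ell_0+\alpha_0(t)|\xi|^\beta\le\ell(t,x,\xi)\le L+\alpha(t)|\xi|^\beta$;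 $\ |\ell(t,x,\xi)-\ell(t,x',\xi)|\le L\big(1+\max(|x|^\mu,|x'|^\mu)\big)|x-x'|^\delta$; $\ \min\{\ell(t,x,\xi)+\ell(t,x+\xi,\xi'),\ \ell(t,x,\xi')+\ell(t,x+\xi',\xi)\}-\ell(t,x,\xi+\xi')\ge\delta_0$; and $\ \ell(t,x,\xi)-L|t-t'|\le\ell(t',x,\xi)\le\ell(t,x,\xi)$. * (Compatibility) $\displaystyle\inf_{\xi\in K,\ x+\xi\in D}\big[h(x+\xi)+\ell(T,x,\xi)\big]<h(x)$ for all $x\in\mathbb R^n\setminus D$. **Conclusion.** $V$ is finite on $[0,T]\times\mathbb R^n$. The minima $$\mathbf N[V](t,x)=\min_{\xi\in K}\{V(t,x+\xi)+\ell(t,x,\xi)\},\qquad \mathbf N^D[h](x)=\min_{\xi\in K,\ x+\xi\in\bar D}\{h(x+\xi)+\ell(T,x,\xi)\}$$ are attained for all $(t,x)\in[0,T]\times\mathbb R^n$. Moreover $V$ is a viscosity solution of $$\min\{V_t+\langle V_x,f\rangle+g,\ \mathbf N[V]-V\}=0\ \text{ on }[0,T)\times\mathbb R^n,\qquad V(T,\cdot)=h^D,$$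 where $h^D=\min\{h,\mathbf N^D[h]\}$ on $\bar D$ and $h^D=\mathbf N^D[h]$ on $\mathbb R^n\setminus\bar D$. That is: $V$ is continuous on $[0,T]\times\mathbb R^n$; $V(T,x)=h^D(x)$ for all $x\in\mathbb R^n$; and for every $\varphi\in C^1([0,T]\times\mathbb R^n)$ and $(t,x)\in[0,T)\times\mathbb R^n$, $$\min\{\varphi_t(t,x)+\langle\varphi_x(t,x),f(t,x)\rangle+g(t,x),\ \mathbf N[V](t,x)-V(t,x)\}\ \begin{cases}\ge0&\text{if }V-\varphi\text{ has a local maximum at }(t,x),\\ \le0&\text{if }V-\varphi\text{ has a local minimum at }(t,x).\end{cases}$$ Local extrema are taken relative to $[0,T]\times\mathbb R^n$, and at $t=0$ the derivative $\varphi_t$ is one-sided. -/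

import Mathlib

open Set MeasureTheory
open scoped Topology Pointwise

noncomputable section

namespace ImpulseQVI

/-- The state space `ℝⁿ` with its Euclidean norm. -/
abbrev State (n : ℕ) : Type := EuclideanSpace ℝ (Fin n)

/-- An impulse control on `[t, T]`: a finite non-decreasing sequence of times in `[t, T]` together
with one impulse in the closed convex cone `K` for each of them.  Coinciding times and zero impulses
are allowed; the trivial control is the one with `N = 0`. -/
structure ImpulseControl {n : ℕ} (K : ProperCone ℝ (State n)) (t T : ℝ) where
  N : ℕ
  time : Fin N → ℝ
  impulse : Fin N → State n
  time_mono : Monotone time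
  time_mem : ∀ k, time k ∈ Icc t T
  impulse_mem : ∀ k, impulse k ∈ K

/-- The process `ξ(s) = ∑ₖ ξₖ 1_{[τₖ, T]}(s)`. -/
def ImpulseControl.path {n : ℕ} {K : ProperCone ℝ (State n)} {t T : ℝ}
    (u : ImpulseControl K t T) (s : ℝ) : State n :=
  ∑ k, (Icc (u.time k) T).indicator (fun _ => u.impulse k) s

/-- `X` solves `X(s) = x + ∫_t^s f(r, X(r)) dr + ξ(s)` on `[t, T]`.  The value before `t` is set to
`x`, so that the left limit `X(t - 0)` is the initial state. -/
structure IsTrajectory {n : ℕ} {K : ProperCone ℝ (State n)} {t T : ℝ}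
    (f : ℝ → State n → State n) (x : State n) (u : ImpulseControl K t T)
    (X : ℝ → State n) : Prop where
  before : ∀ s < t, X s = x
  integrable : IntervalIntegrable (fun r => f r (X r)) volume t T
  eqn : ∀ s ∈ Icc t T, X s = x + (∫ r in t..s, f r (X r)) + u.path s

/-- The state just before the `k`-th impulse: the left limit `X(τₖ - 0)` plus the impulses with
smaller index that are made at the same time. -/
def stateBefore {n : ℕ} {K : ProperCone ℝ (State n)} {t T : ℝ}
    (u : ImpulseControl K t T) (X : ℝ → State n) (k : Fin u.N) : State n :=
  Function.leftLim X (u.time k) +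
    ∑ j with j < k ∧ u.time j = u.time k, u.impulse j

/-- The cost `∫_t^T g(s, X(s)) ds + h(X(T)) + ∑ₖ ℓ(τₖ, X(τₖ - 0), ξₖ)`. -/
def cost {n : ℕ} {K : ProperCone ℝ (State n)} {t T : ℝ}
    (g : ℝ → State n → ℝ) (h : State n → ℝ) (l : ℝ → State n → State n → ℝ)
    (u : ImpulseControl K t T) (X : ℝ → State n) : ℝ :=
  (∫ s in t..T, g s (X s)) + h (X T) +
    ∑ k, l (u.time k) (stateBefore u X k) (u.impulse k)

/-- The value function: the infimum of the cost over all impulse controls whose trajectory ends in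
`closure D`; it is `⊤` where there is none. -/
def value {n : ℕ} (K : ProperCone ℝ (State n)) (D : Set (State n)) (T : ℝ)
    (f : ℝ → State n → State n) (g : ℝ → State n → ℝ) (h : State n → ℝ)
    (l : ℝ → State n → State n → ℝ) (t : ℝ) (x : State n) : EReal :=
  ⨅ (u : ImpulseControl K t T) (X : ℝ → State n) (_ : IsTrajectory f x u X)
    (_ : X T ∈ closure D), (cost g h l u X : EReal)

/-- The set of pairs `(t, x)` with `0 ≤ t ≤ T`. -/
def strip (n : ℕ) (T : ℝ) : Set (ℝ × State n) := Icc 0 T ×ˢ univ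

/-- `D` is a proper domain, and either `D` is bounded and `K = ℝⁿ`, or `D` is conic with vertex at
the origin and `D - K = ℝⁿ`. -/
structure TargetHyp {n : ℕ} (K : ProperCone ℝ (State n)) (D : Set (State n)) : Prop where
  isOpen : IsOpen D
  isConnected : IsConnected D
  ne_univ : D ≠ univ
  bounded_or_conic :
    (Bornology.IsBounded D ∧ (K : Set (State n)) = univ) ∨
      ((∀ c : ℝ, 0 < c → ∀ x ∈ D, c • x ∈ D) ∧ D - (K : Set (State n)) = univ)

/-- Hypotheses on the dynamics. -/
structure DriftHyp {n : ℕ} (T L : ℝ) (f : ℝ → State n → State n) : Prop where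
  continuousOn : ContinuousOn (fun p : ℝ × State n => f p.1 p.2) (strip n T)
  lipschitz : ∀ t ∈ Icc 0 T, ∀ x x', ‖f t x - f t x'‖ ≤ L * ‖x - x'‖
  bound_zero : ∀ t ∈ Icc 0 T, ‖f t 0‖ ≤ L

/-- Hypotheses on the running cost and the terminal cost. -/
structure CostHyp {n : ℕ} (T L μ δ : ℝ) (g : ℝ → State n → ℝ) (h : State n → ℝ) : Prop where
  continuousOn_g : ContinuousOn (fun p : ℝ × State n => g p.1 p.2) (strip n T)
  continuous_h : Continuous h
  g_nonneg : ∀ t ∈ Icc 0 T, ∀ x, 0 ≤ g t x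
  h_nonneg : ∀ x, 0 ≤ h x
  g_le : ∀ t ∈ Icc 0 T, ∀ x, g t x ≤ L * (1 + ‖x‖ ^ (μ + δ))
  h_le : ∀ x, h x ≤ L * (1 + ‖x‖ ^ (μ + δ))
  g_holder : ∀ t ∈ Icc 0 T, ∀ x x',
    |g t x - g t x'| ≤ L * (1 + max (‖x‖ ^ μ) (‖x'‖ ^ μ)) * ‖x - x'‖ ^ δ
  h_holder : ∀ x x',
    |h x - h x'| ≤ L * (1 + max (‖x‖ ^ μ) (‖x'‖ ^ μ)) * ‖x - x'‖ ^ δ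

/-- Hypotheses on the impulse cost; `l0 > 0` and `lower` make it strictly positive. -/
structure ImpulseCostHyp {n : ℕ} (K : ProperCone ℝ (State n)) (T L μ δ l0 δ0 β : ℝ)
    (α0 α : ℝ → ℝ) (l : ℝ → State n → State n → ℝ) : Prop where
  l0_pos : 0 < l0
  δ0_pos : 0 < δ0
  β_pos : 0 < β
  β_le_one : β ≤ 1
  α0_pos : ∀ t ∈ Icc 0 T, 0 < α0 t
  α_pos : ∀ t ∈ Icc 0 T, 0 < α t
  α0_continuousOn : ContinuousOn α0 (Icc 0 T)
  α_continuousOn : ContinuousOn α (Icc 0 T)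
  α0_antitoneOn : AntitoneOn α0 (Icc 0 T)
  α_antitoneOn : AntitoneOn α (Icc 0 T)
  continuousOn : ContinuousOn (fun p : ℝ × State n × State n => l p.1 p.2.1 p.2.2)
    (Icc 0 T ×ˢ (univ ×ˢ (K : Set (State n))))
  lower : ∀ t ∈ Icc 0 T, ∀ x, ∀ ξ ∈ K, l0 + α0 t * ‖ξ‖ ^ β ≤ l t x ξ
  upper : ∀ t ∈ Icc 0 T, ∀ x, ∀ ξ ∈ K, l t x ξ ≤ L + α t * ‖ξ‖ ^ β
  holder : ∀ t ∈ Icc 0 T, ∀ ξ ∈ K, ∀ x x',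
    |l t x ξ - l t x' ξ| ≤ L * (1 + max (‖x‖ ^ μ) (‖x'‖ ^ μ)) * ‖x - x'‖ ^ δ
  subadditive : ∀ t ∈ Icc 0 T, ∀ x, ∀ ξ ∈ K, ∀ ξ' ∈ K,
    δ0 ≤ min (l t x ξ + l t (x + ξ) ξ') (l t x ξ' + l t (x + ξ') ξ) - l t x (ξ + ξ')
  time_lower : ∀ t ∈ Icc 0 T, ∀ t' ∈ Icc 0 T, t ≤ t' → ∀ x, ∀ ξ ∈ K,
    l t x ξ - L * |t - t'| ≤ l t' x ξ
  time_upper : ∀ t ∈ Icc 0 T, ∀ t' ∈ Icc 0 T, t ≤ t' → ∀ x, ∀ ξ ∈ K,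
    l t' x ξ ≤ l t x ξ

/-- Compatibility of terminal cost and impulse cost: outside `D` an impulse into `D` at time `T`
strictly lowers the cost. -/
def Compatible {n : ℕ} (K : ProperCone ℝ (State n)) (D : Set (State n)) (T : ℝ)
    (h : State n → ℝ) (l : ℝ → State n → State n → ℝ) : Prop :=
  ∀ x ∉ D, (⨅ (ξ ∈ K) (_ : x + ξ ∈ D), ((h (x + ξ) + l T x ξ : ℝ) : EReal)) < (h x : EReal)

/-- The obstacle operator `N[V](t, x) = inf_{ξ ∈ K} (V(t, x + ξ) + ℓ(t, x, ξ))`. -/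
def obstacle {n : ℕ} (K : ProperCone ℝ (State n)) (l : ℝ → State n → State n → ℝ)
    (V : ℝ → State n → ℝ) (t : ℝ) (x : State n) : EReal :=
  ⨅ ξ ∈ K, ((V t (x + ξ) + l t x ξ : ℝ) : EReal)

/-- `N^D[h](x) = inf {h(x + ξ) + ℓ(T, x, ξ) | ξ ∈ K, x + ξ ∈ closure D}`. -/
def terminalObstacle {n : ℕ} (K : ProperCone ℝ (State n)) (D : Set (State n)) (T : ℝ)
    (h : State n → ℝ) (l : ℝ → State n → State n → ℝ) (x : State n) : EReal :=
  ⨅ (ξ ∈ K) (_ : x + ξ ∈ closure D), ((h (x + ξ) + l T x ξ : ℝ) : EReal)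

open scoped Classical in
/-- The terminal value `h^D`. -/
def terminalValue {n : ℕ} (K : ProperCone ℝ (State n)) (D : Set (State n)) (T : ℝ)
    (h : State n → ℝ) (l : ℝ → State n → State n → ℝ) (x : State n) : EReal :=
  if x ∈ closure D then min (h x : EReal) (terminalObstacle K D T h l x)
  else terminalObstacle K D T h l x

/-- `φ_t + ⟨φ_x, f⟩ + g` at `(t, x)`; the time derivative is one-sided at the ends of `[0, T]`. -/
def hamiltonian {n : ℕ} (T : ℝ) (f : ℝ → State n → State n) (g : ℝ → State n → ℝ)
    (φ : ℝ → State n → ℝ) (t : ℝ) (x : State n) : ℝ :=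
  derivWithin (fun s => φ s x) (Icc 0 T) t + inner ℝ (gradient (φ t) x) (f t x) + g t x

/-- `min {φ_t + ⟨φ_x, f⟩ + g, N[V] - V}` at `(t, x)`. -/
def qviExpr {n : ℕ} (K : ProperCone ℝ (State n)) (T : ℝ)
    (f : ℝ → State n → State n) (g : ℝ → State n → ℝ) (l : ℝ → State n → State n → ℝ)
    (V φ : ℝ → State n → ℝ) (t : ℝ) (x : State n) : EReal :=
  min (hamiltonian T f g φ t x : EReal) (obstacle K l V t x - (V t x : EReal))

/-- Viscosity sub-solutions of `min {V_t + ⟨V_x, f⟩ + g, N[V] - V} = 0` on `[0, T) × ℝⁿ` with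
terminal value `h^D`. -/
structure IsViscositySubsolution {n : ℕ} (K : ProperCone ℝ (State n)) (D : Set (State n)) (T : ℝ)
    (f : ℝ → State n → State n) (g : ℝ → State n → ℝ) (h : State n → ℝ)
    (l : ℝ → State n → State n → ℝ) (V : ℝ → State n → ℝ) : Prop where
  continuousOn : ContinuousOn (fun p : ℝ × State n => V p.1 p.2) (strip n T)
  terminal : ∀ x, (V T x : EReal) ≤ terminalValue K D T h l x
  interior : ∀ φ : ℝ → State n → ℝ,
    ContDiffOn ℝ 1 (fun p : ℝ × State n => φ p.1 p.2) (strip n T) →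
    ∀ t ∈ Ico 0 T, ∀ x,
      IsLocalMaxOn (fun p : ℝ × State n => V p.1 p.2 - φ p.1 p.2) (strip n T) (t, x) →
      0 ≤ qviExpr K T f g l V φ t x

/-- Viscosity super-solutions of the same problem. -/
structure IsViscositySupersolution {n : ℕ} (K : ProperCone ℝ (State n)) (D : Set (State n)) (T : ℝ)
    (f : ℝ → State n → State n) (g : ℝ → State n → ℝ) (h : State n → ℝ)
    (l : ℝ → State n → State n → ℝ) (V : ℝ → State n → ℝ) : Prop where
  continuousOn : ContinuousOn (fun p : ℝ × State n => V p.1 p.2) (strip n T)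
  terminal : ∀ x, terminalValue K D T h l x ≤ (V T x : EReal)
  interior : ∀ φ : ℝ → State n → ℝ,
    ContDiffOn ℝ 1 (fun p : ℝ × State n => φ p.1 p.2) (strip n T) →
    ∀ t ∈ Ico 0 T, ∀ x,
      IsLocalMinOn (fun p : ℝ × State n => V p.1 p.2 - φ p.1 p.2) (strip n T) (t, x) →
      qviExpr K T f g l V φ t x ≤ 0

/-- Viscosity solutions of the quasi-variational inequality with terminal value `h^D`. -/
def IsViscositySolution {n : ℕ} (K : ProperCone ℝ (State n)) (D : Set (State n)) (T : ℝ)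
    (f : ℝ → State n → State n) (g : ℝ → State n → ℝ) (h : State n → ℝ)
    (l : ℝ → State n → State n → ℝ) (V : ℝ → State n → ℝ) : Prop :=
  IsViscositySupersolution K D T f g h l V ∧ IsViscositySubsolution K D T f g h l V

end ImpulseQVI

end

open ImpulseQVI

/-! Between impulses the state follows the flow `Φ` of `f`. A control with `N + 1` impulses is
therefore a first time, a first impulse, and a control with `N` impulses from the state reached.
`Attains` encodes this recursion together with the cost, and the value `V(t, x)` is the least
attainable cost (`value_eq_of_isLeast`). The properties of `V` are read off from attainable costs,
mostly by induction along the recursion.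

Existence of optimal controls and lower semicontinuity come from compactness. Every impulse costs at
least `l0` and large impulses are expensive, so a bound on the cost bounds the number and the size
of the impulses. Hence the triples `(t, x, c)` with `c` attainable from `(t, x)` and `c ≤ C` form a
closed set (`isClosed_exists_attains`). Finiteness holds because one impulse at time `T` can reach
`D` from any state.

Upper semicontinuity has to cope with the terminal constraint: a trajectory ending on the boundary
of `D` may leave `closure D` under a small perturbation. By compatibility, one more impulse at time
`T` moves such an endpoint into the open set `D` without raising the cost (`Attains.improve`).
Ending in `D` is stable under perturbation of the initial data (`Attains.eventually`).

The equation is dynamic programming. `V` is at most the cost of coasting plus the later value, and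
at most the cost of an impulse plus the value after it. An optimal control either jumps at once or
coasts for a while, so one of the two is an equality. Differentiating a test function along the flow
turns this into the viscosity inequalities. At time `T`, subadditivity of the impulse cost merges
all impulses into one, which gives `h^D`. -/

namespace ImpulseQVI

/-! ### Integral curves and the flow of a Lipschitz field. -/

section Flow

variable {E : Type*} [NormedAddCommGroup E] [NormedSpace ℝ E]

/-- Forward Gronwall estimate for two integral curves of the same Lipschitz field. -/
theorem dist_le_of_isIntegralCurveOn_forward {v : ℝ → E → E} {K : NNReal} {a b s t : ℝ}
    {Y Z : ℝ → E} (hv : ∀ r ∈ Icc a b, LipschitzWith K (v r))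
    (hY : IsIntegralCurveOn Y v (Icc a b)) (hZ : IsIntegralCurveOn Z v (Icc a b))
    (ht : t ∈ Icc a b) (hs : s ∈ Icc a b) (hts : t ≤ s) :
    dist (Y s) (Z s) ≤ dist (Y t) (Z t) * Real.exp (K * (s - t)) := by
  have hsub : Icc t b ⊆ Icc a b := Icc_subset_Icc_left ht.1
  have key : ∀ {W : ℝ → E}, IsIntegralCurveOn W v (Icc a b) →
      ∀ r ∈ Ico t b, HasDerivWithinAt W (v r (W r)) (Ici r) r := fun hW r hr =>
    (hW r (hsub ⟨hr.1, hr.2.le⟩)).mono_of_mem_nhdsWithin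
      (Icc_mem_nhdsGE_of_mem ⟨ht.1.trans hr.1, hr.2⟩)
  exact dist_le_of_trajectories_ODE_of_mem (s := fun _ => univ)
    (fun r hr => (hv r (hsub ⟨hr.1, hr.2.le⟩)).lipschitzOnWith)
    (hY.continuousOn.mono hsub) (key hY) (fun _ _ => mem_univ _)
    (hZ.continuousOn.mono hsub) (key hZ) (fun _ _ => mem_univ _) le_rfl s ⟨hts, hs.2⟩

/-- Time reversal, which turns the forward Gronwall estimate into a backward one. -/
theorem IsIntegralCurveOn.comp_neg {v : ℝ → E → E} {a b : ℝ} {Y : ℝ → E}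
    (hY : IsIntegralCurveOn Y v (Icc a b)) :
    IsIntegralCurveOn (fun r => Y (-r)) (fun r x => -v (-r) x) (Icc (-b) (-a)) := by
  intro r hr
  have h1 := hY (-r) ⟨by linarith [hr.2], by linarith [hr.1]⟩
  have h2 := h1.scomp r (hasDerivAt_neg r).hasDerivWithinAt (s := Icc (-b) (-a))
    (fun q hq => ⟨by linarith [hq.2], by linarith [hq.1]⟩)
  simpa [Function.comp_def] using h2

/-- Two-sided Gronwall estimate. -/
theorem dist_le_of_isIntegralCurveOn {v : ℝ → E → E} {K : NNReal} {a b s t : ℝ}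
    {Y Z : ℝ → E} (hv : ∀ r ∈ Icc a b, LipschitzWith K (v r))
    (hY : IsIntegralCurveOn Y v (Icc a b)) (hZ : IsIntegralCurveOn Z v (Icc a b))
    (ht : t ∈ Icc a b) (hs : s ∈ Icc a b) :
    dist (Y s) (Z s) ≤ dist (Y t) (Z t) * Real.exp (K * |s - t|) := by
  rcases le_total t s with h | h
  · rw [abs_of_nonneg (sub_nonneg.2 h)]
    exact dist_le_of_isIntegralCurveOn_forward hv hY hZ ht hs h
  · have := dist_le_of_isIntegralCurveOn_forward (v := fun r x => -v (-r) x) (s := -s) (t := -t)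
      (K := K) (fun r hr => (hv (-r) ⟨by linarith [hr.2], by linarith [hr.1]⟩).neg)
      hY.comp_neg hZ.comp_neg ⟨by linarith [ht.2], by linarith [ht.1]⟩
      ⟨by linarith [hs.2], by linarith [hs.1]⟩ (by linarith)
    rw [abs_of_nonpos (sub_nonpos.2 h)]
    simpa [neg_add_eq_sub] using this

theorem eqOn_of_isIntegralCurveOn {v : ℝ → E → E} {K : NNReal} {a b t : ℝ}
    {Y Z : ℝ → E} (hv : ∀ r ∈ Icc a b, LipschitzWith K (v r))
    (hY : IsIntegralCurveOn Y v (Icc a b)) (hZ : IsIntegralCurveOn Z v (Icc a b))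
    (ht : t ∈ Icc a b) (h : Y t = Z t) : EqOn Y Z (Icc a b) := fun s hs => by
  have := dist_le_of_isIntegralCurveOn hv hY hZ ht hs
  rw [h, dist_self, zero_mul] at this
  exact dist_le_zero.1 this

/-- Gluing two integral curves at a common endpoint. -/
theorem IsIntegralCurveOn.glue {v : ℝ → E → E} {a m b : ℝ} {Y Z : ℝ → E} (ham : a ≤ m)
    (hmb : m ≤ b) (hY : IsIntegralCurveOn Y v (Icc a m)) (hZ : IsIntegralCurveOn Z v (Icc m b))
    (h : Y m = Z m) :
    IsIntegralCurveOn (fun r => if r ≤ m then Y r else Z r) v (Icc a b) := by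
  set W : ℝ → E := fun r => if r ≤ m then Y r else Z r
  have e1 : EqOn W Y (Icc a m) := fun r hr => if_pos hr.2
  have e2 : EqOn W Z (Icc m b) := fun r hr => by
    rcases hr.1.eq_or_lt with rfl | hlt
    · simp [W, h]
    · exact if_neg (not_le.2 hlt)
  have d1 : IsIntegralCurveOn W v (Icc a m) := fun r hr => by
    have := (hY r hr).congr_of_mem e1 hr
    rwa [← e1 hr] at this
  have d2 : IsIntegralCurveOn W v (Icc m b) := fun r hr => by
    have := (hZ r hr).congr_of_mem e2 hr
    rwa [← e2 hr] at this
  -- Away from the closure of a set every vector is a derivative within it, so each half of the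
  -- union matters only at its own points.
  have hout : ∀ {c d r : ℝ}, r ∉ Icc c d → HasDerivWithinAt W (v r (W r)) (Icc c d) r :=
    fun hr => HasFDerivWithinAt.of_notMem_closure (by rwa [isClosed_Icc.closure_eq])
  intro r _
  rw [← Icc_union_Icc_eq_Icc ham hmb]
  refine HasDerivWithinAt.union ?_ ?_
  · by_cases hr : r ∈ Icc a m
    exacts [d1 r hr, hout hr]
  · by_cases hr : r ∈ Icc m b
    exacts [d2 r hr, hout hr]

variable [CompleteSpace E]

/-- Existence on an interval of length at most `1 / (2 L)` for a field of linear growth. -/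
theorem exists_isIntegralCurveOn_short {v : ℝ → E → E} {L : ℝ} (hL : 0 < L) {a b t : ℝ}
    (hv : ∀ r ∈ Icc a b, LipschitzWith L.toNNReal (v r))
    (hc : ∀ x, ContinuousOn (fun r => v r x) (Icc a b)) (h0 : ∀ r ∈ Icc a b, ‖v r 0‖ ≤ L)
    (hab : 2 * L * (b - a) ≤ 1) (ht : t ∈ Icc a b) (x : E) :
    ∃ Y : ℝ → E, Y t = x ∧ IsIntegralCurveOn Y v (Icc a b) := by
  have hx : 0 ≤ 1 + ‖x‖ := by positivity
  -- In the ball of radius `1 + ‖x‖` around `x` the speed is at most `L + L (1 + 2‖x‖) = 2L(1 +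
  -- ‖x‖)`, so a curve stays in the ball for time `1 / (2L)`, whatever `x` is.
  have hpl : IsPicardLindelof v (⟨t, ht⟩ : Icc a b) x (1 + ‖x‖).toNNReal 0
      (2 * L * (1 + ‖x‖)).toNNReal L.toNNReal :=
    { lipschitzOnWith := fun r hr => (hv r hr).lipschitzOnWith
      continuousOn := fun y _ => hc y
      norm_le := fun r hr y hy => by
        rw [Real.coe_toNNReal _ (by positivity)]
        rw [Real.coe_toNNReal _ hx, Metric.mem_closedBall] at hy
        have h1 := (hv r hr).dist_le_mul y 0
        rw [Real.coe_toNNReal _ hL.le, dist_zero_right, dist_eq_norm] at h1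
        have h2 : ‖y‖ ≤ 1 + 2 * ‖x‖ := by
          have := norm_le_norm_add_norm_sub' y x
          rw [dist_eq_norm] at hy; linarith
        have h3 : ‖v r y‖ ≤ ‖v r 0‖ + ‖v r y - v r 0‖ := norm_le_norm_add_norm_sub' _ _
        have h4 := h0 r hr
        nlinarith
      mul_max_le := by
        have hm : max (b - t) (t - a) ≤ b - a := max_le (by linarith [ht.1]) (by linarith [ht.2])
        rw [Real.coe_toNNReal _ (by positivity), Real.coe_toNNReal _ hx]
        simp only [NNReal.coe_zero, sub_zero]
        calc 2 * L * (1 + ‖x‖) * max (b - t) (t - a) ≤ 2 * L * (1 + ‖x‖) * (b - a) := by gcongr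
          _ = (2 * L * (b - a)) * (1 + ‖x‖) := by ring
          _ ≤ 1 * (1 + ‖x‖) := by gcongr
          _ = 1 + ‖x‖ := one_mul _ }
  obtain ⟨Y, hY, hY'⟩ := hpl.exists_eq_forall_mem_Icc_hasDerivWithinAt₀
  exact ⟨Y, hY, hY'⟩

/-- Bisection: solve on the half that contains `t`, continue from the midpoint into the other half,
and glue. The admissible length doubles with each `k`. -/
theorem exists_isIntegralCurveOn_doubling {v : ℝ → E → E} {L : ℝ} (hL : 0 < L) (k : ℕ) :
    ∀ {a b t : ℝ}, (∀ r ∈ Icc a b, LipschitzWith L.toNNReal (v r)) →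
    (∀ x, ContinuousOn (fun r => v r x) (Icc a b)) → (∀ r ∈ Icc a b, ‖v r 0‖ ≤ L) →
    2 * L * (b - a) ≤ 2 ^ k → t ∈ Icc a b → ∀ x : E,
    ∃ Y : ℝ → E, Y t = x ∧ IsIntegralCurveOn Y v (Icc a b) := by
  induction k with
  | zero =>
    intro a b t hv hc h0 hab ht x
    exact exists_isIntegralCurveOn_short hL hv hc h0 (by simpa using hab) ht x
  | succ k ih =>
    intro a b t hv hc h0 hab ht x
    have hle : a ≤ b := ht.1.trans ht.2
    obtain ⟨m, hm⟩ : ∃ m, m = (a + b) / 2 := ⟨_, rfl⟩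
    have ham : a ≤ m := by linarith
    have hmb : m ≤ b := by linarith
    have s1 : Icc a m ⊆ Icc a b := Icc_subset_Icc_right hmb
    have s2 : Icc m b ⊆ Icc a b := Icc_subset_Icc_left ham
    have l1 : 2 * L * (m - a) ≤ 2 ^ k := by rw [pow_succ] at hab; rw [hm]; linarith
    have l2 : 2 * L * (b - m) ≤ 2 ^ k := by rw [pow_succ] at hab; rw [hm]; linarith
    have ih1 := fun {t} => ih (t := t) (fun r hr => hv r (s1 hr)) (fun x => (hc x).mono s1)
      (fun r hr => h0 r (s1 hr)) l1
    have ih2 := fun {t} => ih (t := t) (fun r hr => hv r (s2 hr)) (fun x => (hc x).mono s2)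
      (fun r hr => h0 r (s2 hr)) l2
    rcases le_or_gt t m with htm | htm
    · obtain ⟨Y, hY, hY'⟩ := ih1 ⟨ht.1, htm⟩ x
      obtain ⟨Z, hZ, hZ'⟩ := ih2 ⟨le_rfl, hmb⟩ (Y m)
      exact ⟨_, by simp [htm, hY], hY'.glue ham hmb hZ' hZ.symm⟩
    · obtain ⟨Z, hZ, hZ'⟩ := ih2 ⟨htm.le, ht.2⟩ x
      obtain ⟨Y, hY, hY'⟩ := ih1 ⟨ham, le_rfl⟩ (Z m)
      exact ⟨_, by simp [htm.not_ge, hZ], hY'.glue ham hmb hZ' hY⟩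

/-- Global existence for a Lipschitz field of linear growth. -/
theorem exists_isIntegralCurveOn {v : ℝ → E → E} {L : ℝ} (hL : 0 < L) {a b t : ℝ}
    (hv : ∀ r ∈ Icc a b, LipschitzWith L.toNNReal (v r))
    (hc : ∀ x, ContinuousOn (fun r => v r x) (Icc a b)) (h0 : ∀ r ∈ Icc a b, ‖v r 0‖ ≤ L)
    (ht : t ∈ Icc a b) (x : E) :
    ∃ Y : ℝ → E, Y t = x ∧ IsIntegralCurveOn Y v (Icc a b) := by
  obtain ⟨k, hk⟩ := pow_unbounded_of_one_lt (2 * L * (b - a)) (one_lt_two (α := ℝ))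
  exact exists_isIntegralCurveOn_doubling hL k hv hc h0 hk.le ht x

end Flow

/-- A continuous two-parameter flow: `Φ t s x` is the state at time `s` of the motion that is in
`x` at time `t`. -/
structure IsFlow {E : Type*} [TopologicalSpace E] (Φ : ℝ → ℝ → E → E) : Prop where
  continuous : Continuous fun p : ℝ × ℝ × E => Φ p.1 p.2.1 p.2.2
  self : ∀ t x, Φ t t x = x
  comp : ∀ t s r x, Φ s r (Φ t s x) = Φ t r x

/-- The flow of a Lipschitz field on `[0, T]`, continued constantly in both times outside of
`[0, T]`. -/
theorem exists_isFlow {E : Type*} [NormedAddCommGroup E] [NormedSpace ℝ E] [CompleteSpace E]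
    {v : ℝ → E → E} {T L : ℝ} (hT : 0 < T) (hL : 0 < L)
    (hv : ∀ r ∈ Icc 0 T, LipschitzWith L.toNNReal (v r))
    (hc : ∀ x, ContinuousOn (fun r => v r x) (Icc 0 T)) (h0 : ∀ r ∈ Icc 0 T, ‖v r 0‖ ≤ L) :
    ∃ Φ : ℝ → ℝ → E → E, IsFlow Φ ∧
      ∀ t x, IsIntegralCurveOn (fun s => Φ t s x) v (Icc 0 T) := by
  choose Y hY hY' using fun (t : Icc (0 : ℝ) T) (x : E) =>
    exists_isIntegralCurveOn hL hv hc h0 t.2 x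
  have hcomp : ∀ t s r : Icc (0 : ℝ) T, ∀ x, Y s (Y t x s) r = Y t x r := fun t s r x =>
    eqOn_of_isIntegralCurveOn hv (hY' s _) (hY' t x) s.2 (hY s _) r.2
  have hcont : Continuous fun p : Icc (0 : ℝ) T × Icc (0 : ℝ) T × E => Y p.1 p.2.2 p.2.1 := by
    rw [continuous_iff_continuousAt]
    rintro ⟨t, s, x⟩
    have hYc : Continuous fun s : Icc (0 : ℝ) T => Y t x s :=
      continuousOn_iff_continuous_domRestrict.1 (hY' t x).continuousOn
    have hY1 : Continuous fun p : Icc (0 : ℝ) T × Icc (0 : ℝ) T × E => Y t x p.1 :=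
      hYc.comp continuous_fst
    have hY2 : Continuous fun p : Icc (0 : ℝ) T × Icc (0 : ℝ) T × E => Y t x p.2.1 :=
      hYc.comp (continuous_fst.comp continuous_snd)
    -- Compare the perturbed curve with the fixed curve `Y t x` at the perturbed initial time `p.1`,
    -- where their distance is `dist p.2.2 (Y t x p.1)`; Gronwall carries this to time `p.2.1`.
    have key : ∀ p : Icc (0 : ℝ) T × Icc (0 : ℝ) T × E,
        dist (Y p.1 p.2.2 p.2.1) (Y t x s) ≤
          dist p.2.2 (Y t x p.1) * Real.exp (L.toNNReal * |(p.2.1 : ℝ) - p.1|)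
            + dist (Y t x p.2.1) (Y t x s) := fun p => by
      refine (dist_triangle _ (Y t x p.2.1) _).trans (add_le_add_left ?_ _)
      have := dist_le_of_isIntegralCurveOn hv (hY' p.1 p.2.2) (hY' t x) p.1.2 p.2.1.2
      rwa [hY] at this
    have hlim : Continuous fun p : Icc (0 : ℝ) T × Icc (0 : ℝ) T × E =>
        dist p.2.2 (Y t x p.1) * Real.exp (L.toNNReal * |(p.2.1 : ℝ) - p.1|)
            + dist (Y t x p.2.1) (Y t x s) :=
      (((continuous_snd.comp continuous_snd).dist hY1).mul (by fun_prop)).add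
        (hY2.dist continuous_const)
    refine tendsto_iff_dist_tendsto_zero.2 (squeeze_zero (fun _ => dist_nonneg) key ?_)
    have := hlim.tendsto (t, s, x)
    simpa [hY] using this
  refine ⟨fun t s x => Y (projIcc 0 T hT.le t) x (projIcc 0 T hT.le s), ⟨?_, ?_, ?_⟩, ?_⟩
  · have hP : Continuous (projIcc 0 T hT.le) := continuous_projIcc
    exact hcont.comp (g := fun p : Icc (0 : ℝ) T × Icc (0 : ℝ) T × E => Y p.1 p.2.2 p.2.1)
      (f := fun p : ℝ × ℝ × E => (projIcc 0 T hT.le p.1, projIcc 0 T hT.le p.2.1, p.2.2))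
      ((hP.comp continuous_fst).prodMk ((hP.comp (continuous_fst.comp continuous_snd)).prodMk
        (continuous_snd.comp continuous_snd)))
  · exact fun t x => hY _ _
  · exact fun t s r x => hcomp _ _ _ _
  · intro t x s hs
    have e : EqOn (fun s => Y (projIcc 0 T hT.le t) x (projIcc 0 T hT.le s))
        (Y (projIcc 0 T hT.le t) x) (Icc 0 T) := fun r hr => by
      simp only [projIcc_of_mem hT.le hr]
    have := (hY' (projIcc 0 T hT.le t) x s hs).congr_of_mem e hs
    rwa [← e hs] at this

/-! ### Running cost along the flow. -/

section RunCost

variable {E : Type*} {Φ : ℝ → ℝ → E → E} {g : ℝ → E → ℝ}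

/-- The running cost accumulated between the times `t` and `s` by the uncontrolled motion. -/
noncomputable def runCost (Φ : ℝ → ℝ → E → E) (g : ℝ → E → ℝ) (t s : ℝ) (x : E) : ℝ :=
  ∫ r in t..s, g r (Φ t r x)

/-- Write the integral from `t` to `s` as a difference of two integrals from the fixed base point
`0`; each depends continuously on its parameters and its upper limit. -/
theorem continuous_runCost [TopologicalSpace E] (hΦ : IsFlow Φ)
    (hg : Continuous fun p : ℝ × E => g p.1 p.2) :
    Continuous fun p : ℝ × ℝ × E => runCost Φ g p.1 p.2.1 p.2.2 := by
  have hF : Continuous (Function.uncurry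
      fun (p : ℝ × ℝ × E) (r : ℝ) => g r (Φ p.1 r p.2.2)) :=
    hg.comp (continuous_snd.prodMk (hΦ.continuous.comp
      (((continuous_fst.comp continuous_fst)).prodMk
        (continuous_snd.prodMk ((continuous_snd.comp continuous_snd).comp continuous_fst)))))
  have h1 := intervalIntegral.continuous_parametric_intervalIntegral_of_continuous (μ := volume)
    (a₀ := 0) hF (s := fun p => p.2.1) (by fun_prop)
  have h2 := intervalIntegral.continuous_parametric_intervalIntegral_of_continuous (μ := volume)
    (a₀ := 0) hF (s := fun p => p.1) (by fun_prop)
  refine (h1.sub h2).congr fun p => ?_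
  have hi : ∀ a b : ℝ, IntervalIntegrable (fun r => g r (Φ p.1 r p.2.2)) volume a b :=
    fun a b => (hF.comp (Continuous.prodMk_right p)).intervalIntegrable a b
  exact intervalIntegral.integral_interval_sub_left (hi _ _) (hi _ _)

theorem continuous_running [TopologicalSpace E] (hΦ : IsFlow Φ)
    (hg : Continuous fun p : ℝ × E => g p.1 p.2)
    (t : ℝ) (x : E) : Continuous fun r => g r (Φ t r x) :=
  hg.comp (continuous_id.prodMk (hΦ.continuous.comp
    (continuous_const.prodMk (continuous_id.prodMk continuous_const))))

theorem runCost_self (t : ℝ) (x : E) : runCost Φ g t t x = 0 := intervalIntegral.integral_same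

theorem runCost_add [TopologicalSpace E] (hΦ : IsFlow Φ)
    (hg : Continuous fun p : ℝ × E => g p.1 p.2)
    (t s r : ℝ) (x : E) :
    runCost Φ g t s x + runCost Φ g s r (Φ t s x) = runCost Φ g t r x := by
  have hi := fun a b => (continuous_running hΦ hg t x).intervalIntegrable (μ := volume) a b
  simp only [runCost, hΦ.comp]
  exact intervalIntegral.integral_add_adjacent_intervals (hi _ _) (hi _ _)

theorem runCost_nonneg (hg : ∀ t x, 0 ≤ g t x) {t s : ℝ} (hts : t ≤ s) (x : E) :
    0 ≤ runCost Φ g t s x :=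
  intervalIntegral.integral_nonneg hts fun _ _ => hg _ _

end RunCost

/-- The set of points whose fibre over a compact set meets a closed set is closed. -/
theorem isClosed_setOf_exists_mem_compact {X Y : Type*} [TopologicalSpace X] [TopologicalSpace Y]
    {Q : Set Y} (hQ : IsCompact Q) {Z : Set (X × Y)} (hZ : IsClosed Z) :
    IsClosed {x | ∃ y ∈ Q, (x, y) ∈ Z} := by
  have := isCompact_iff_compactSpace.1 hQ
  have h := isClosedMap_fst_of_compactSpace (X := X) (Y := Q) _
    (hZ.preimage (f := fun p : X × Q => (p.1, (p.2 : Y))) (by fun_prop))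
  convert h using 1
  ext x
  constructor
  · rintro ⟨y, hy, hxy⟩
    exact ⟨(x, ⟨y, hy⟩), hxy, rfl⟩
  · rintro ⟨⟨x', y⟩, hxy, rfl⟩
    exact ⟨y, y.2, hxy⟩

/-! ### Controls as a recursion: attainable costs. -/

section Attains

variable {E : Type*} [NormedAddCommGroup E]

/-- `Attains Φ g h l K T B N t x c`: starting in `x` at time `t`, an impulse control with `N`
impulses steers the state into `B` at time `T` with total cost `c`. -/
inductive Attains (Φ : ℝ → ℝ → E → E) (g : ℝ → E → ℝ) (h : E → ℝ) (l : ℝ → E → E → ℝ) (K : Set E)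
    (T : ℝ) (B : Set E) : ℕ → ℝ → E → ℝ → Prop
  | coast {t : ℝ} {x : E} (htT : t ≤ T) (hB : Φ t T x ∈ B) :
      Attains Φ g h l K T B 0 t x (runCost Φ g t T x + h (Φ t T x))
  | jump {N : ℕ} {t τ : ℝ} {x ξ : E} {c : ℝ} (htτ : t ≤ τ) (hξ : ξ ∈ K)
      (hc : Attains Φ g h l K T B N τ (Φ t τ x + ξ) c) :
      Attains Φ g h l K T B (N + 1) t x (runCost Φ g t τ x + l τ (Φ t τ x) ξ + c)

/-- Standing assumptions: continuous flow and costs, non-negativity, and impulse costs that are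
bounded below by `l0 > 0` and coercive. -/
structure ControlData (Φ : ℝ → ℝ → E → E) (g : ℝ → E → ℝ) (h : E → ℝ) (l : ℝ → E → E → ℝ)
    (K : Set E) (T l0 : ℝ) : Prop where
  isFlow : IsFlow Φ
  continuous_g : Continuous fun p : ℝ × E => g p.1 p.2
  continuous_h : Continuous h
  continuous_l : Continuous fun p : ℝ × E × E => l p.1 p.2.1 p.2.2
  g_nonneg : ∀ t x, 0 ≤ g t x
  h_nonneg : ∀ x, 0 ≤ h x
  isClosed : IsClosed K
  l0_pos : 0 < l0
  l0_le : ∀ t ∈ Icc 0 T, ∀ x, ∀ ξ ∈ K, l0 ≤ l t x ξ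
  coercive : ∀ C, ∃ R, ∀ t ∈ Icc 0 T, ∀ x, ∀ ξ ∈ K, l t x ξ ≤ C → ‖ξ‖ ≤ R

variable {Φ : ℝ → ℝ → E → E} {g : ℝ → E → ℝ} {h : E → ℝ} {l : ℝ → E → E → ℝ} {K : Set E}
  {T l0 : ℝ} {B : Set E} {N : ℕ} {t s : ℝ} {x ξ : E} {c : ℝ}

theorem Attains.le (ha : Attains Φ g h l K T B N t x c) : t ≤ T := by
  induction ha with
  | coast htT _ => exact htT
  | jump htτ _ _ ih => exact htτ.trans ih

/-- Each impulse contributes at least `l0` and all other costs are non-negative. This is what bounds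
the number of impulses by the cost. -/
theorem Attains.mul_le (H : ControlData Φ g h l K T l0) (ha : Attains Φ g h l K T B N t x c)
    (ht : 0 ≤ t) : N * l0 ≤ c := by
  induction ha with
  | coast htT _ =>
    simpa using add_nonneg (runCost_nonneg H.g_nonneg htT _) (H.h_nonneg _)
  | @jump N t τ x ξ c htτ hξ hc ih =>
    have h1 := ih (ht.trans htτ)
    have h2 := H.l0_le τ ⟨ht.trans htτ, hc.le⟩ (Φ t τ x) ξ hξ
    have h3 := runCost_nonneg H.g_nonneg htτ x (Φ := Φ)
    push_cast
    linarith

theorem Attains.nonneg (H : ControlData Φ g h l K T l0) (ha : Attains Φ g h l K T B N t x c)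
    (ht : 0 ≤ t) : 0 ≤ c :=
  (mul_nonneg N.cast_nonneg H.l0_pos.le).trans (ha.mul_le H ht)

theorem Attains.mono {B' : Set E} (hB : B ⊆ B') (ha : Attains Φ g h l K T B N t x c) :
    Attains Φ g h l K T B' N t x c := by
  induction ha with
  | coast htT h => exact .coast htT (hB h)
  | jump htτ hξ _ ih => exact .jump htτ hξ ih

/-- The sublevel sets of the attainable costs are closed. -/
theorem isClosed_attains [ProperSpace E] (H : ControlData Φ g h l K T l0) (hB : IsClosed B)
    (C : ℝ) (N : ℕ) :
    IsClosed {p : ℝ × E × ℝ | 0 ≤ p.1 ∧ p.2.2 ≤ C ∧ Attains Φ g h l K T B N p.1 p.2.1 p.2.2} := by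
  have hΦ := H.isFlow.continuous
  have hG := continuous_runCost H.isFlow H.continuous_g
  induction N with
  | zero =>
    have hend : Continuous fun p : ℝ × E × ℝ => Φ p.1 T p.2.1 :=
      hΦ.comp (by fun_prop : Continuous fun p : ℝ × E × ℝ => (p.1, T, p.2.1))
    have hrun : Continuous fun p : ℝ × E × ℝ => runCost Φ g p.1 T p.2.1 :=
      hG.comp (by fun_prop : Continuous fun p : ℝ × E × ℝ => (p.1, T, p.2.1))
    have hcl : IsClosed {p : ℝ × E × ℝ | 0 ≤ p.1 ∧ p.2.2 ≤ C ∧ p.1 ≤ T ∧ Φ p.1 T p.2.1 ∈ B ∧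
        p.2.2 = runCost Φ g p.1 T p.2.1 + h (Φ p.1 T p.2.1)} := by
      have hmem : IsClosed {p : ℝ × E × ℝ | Φ p.1 T p.2.1 ∈ B} := hB.preimage hend
      have heq : IsClosed {p : ℝ × E × ℝ | p.2.2 = runCost Φ g p.1 T p.2.1 + h (Φ p.1 T p.2.1)} :=
        isClosed_eq (by fun_prop) (hrun.add (H.continuous_h.comp hend))
      exact (isClosed_le (by fun_prop) (by fun_prop)).and
        ((isClosed_le (by fun_prop) (by fun_prop)).and
          ((isClosed_le (by fun_prop) (by fun_prop)).and (hmem.and heq)))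
    convert hcl using 1
    ext ⟨t, x, c⟩
    simp only [mem_ofPred_eq]
    refine and_congr_right fun _ => and_congr_right fun _ => ⟨fun ha => ?_, fun ha => ?_⟩
    · cases ha with | coast h1 h2 => exact ⟨h1, h2, rfl⟩
    · rw [ha.2.2]; exact .coast ha.1 ha.2.1
  -- With total cost at most `C` the first impulse costs at most `C`, so coercivity confines the
  -- first time and impulse to a compact set. The set in question is the projection along it of a
  -- closed set, the preimage of the one for `N` under the passage to the remaining data.
  | succ N ih =>
    obtain ⟨R, hR⟩ := H.coercive C
    have hQ : IsCompact (Icc 0 T ×ˢ (K ∩ Metric.closedBall 0 R)) :=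
      isCompact_Icc.prod ((isCompact_closedBall 0 R).inter_left H.isClosed)
    have e3 : Continuous fun q : (ℝ × E × ℝ) × (ℝ × E) => (q.1.1, q.2.1, q.1.2.1) := by fun_prop
    have hend := hΦ.comp e3
    have hrun := hG.comp e3
    have hl := H.continuous_l.comp
      ((by fun_prop : Continuous fun q : (ℝ × E × ℝ) × (ℝ × E) => q.2.1).prodMk
        (hend.prodMk (by fun_prop : Continuous fun q : (ℝ × E × ℝ) × (ℝ × E) => q.2.2)))
    have hmap : Continuous fun q : (ℝ × E × ℝ) × (ℝ × E) =>
        (q.2.1, Φ q.1.1 q.2.1 q.1.2.1 + q.2.2,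
          q.1.2.2 - (runCost Φ g q.1.1 q.2.1 q.1.2.1 + l q.2.1 (Φ q.1.1 q.2.1 q.1.2.1) q.2.2)) :=
      (by fun_prop : Continuous fun q : (ℝ × E × ℝ) × (ℝ × E) => q.2.1).prodMk
        ((hend.add (by fun_prop)).prodMk
          ((by fun_prop : Continuous fun q : (ℝ × E × ℝ) × (ℝ × E) => q.1.2.2).sub
            (hrun.add hl)))
    have hZ : IsClosed {q : (ℝ × E × ℝ) × (ℝ × E) | 0 ≤ q.1.1 ∧ q.1.1 ≤ q.2.1 ∧ q.1.2.2 ≤ C ∧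
        (q.2.1, Φ q.1.1 q.2.1 q.1.2.1 + q.2.2,
          q.1.2.2 - (runCost Φ g q.1.1 q.2.1 q.1.2.1 + l q.2.1 (Φ q.1.1 q.2.1 q.1.2.1) q.2.2)) ∈
        {p : ℝ × E × ℝ | 0 ≤ p.1 ∧ p.2.2 ≤ C ∧ Attains Φ g h l K T B N p.1 p.2.1 p.2.2}} := by
      exact (isClosed_le (by fun_prop) (by fun_prop)).and
        ((isClosed_le (by fun_prop) (by fun_prop)).and
          ((isClosed_le (by fun_prop) (by fun_prop)).and (ih.preimage hmap)))
    convert isClosed_setOf_exists_mem_compact hQ hZ using 1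
    ext ⟨t, x, c⟩
    simp only [mem_ofPred_eq]
    constructor
    · rintro ⟨ht, hcC, ha⟩
      generalize hM : N + 1 = M at ha
      cases ha with
      | coast _ _ => omega
      | @jump N' _ τ _ ξ c' htτ hξ hc =>
        obtain rfl : N = N' := by omega
        have hτ : τ ∈ Icc 0 T := ⟨ht.trans htτ, hc.le⟩
        have h0 := hc.nonneg H hτ.1
        have h1 := runCost_nonneg H.g_nonneg htτ x (Φ := Φ)
        have h2 := H.l0_le τ hτ (Φ t τ x) ξ hξ
        have h3 := H.l0_pos
        refine ⟨(τ, ξ), ⟨hτ, hξ, ?_⟩, ht, htτ, hcC, hτ.1, by dsimp only; linarith, ?_⟩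
        · rw [mem_closedBall_zero_iff]
          exact hR τ hτ _ ξ hξ (by linarith)
        · simpa using hc
    · rintro ⟨⟨τ, ξ⟩, ⟨_, hξ, _⟩, ht, htτ, hcC, _, _, ha⟩
      refine ⟨ht, hcC, ?_⟩
      have := Attains.jump htτ hξ ha
      rwa [add_sub_cancel] at this

/-- At most `C / l0` impulses fit into the cost `C`, so this is a finite union of closed sets. -/
theorem isClosed_exists_attains [ProperSpace E] (H : ControlData Φ g h l K T l0)
    (hB : IsClosed B) (C : ℝ) :
    IsClosed {p : ℝ × E × ℝ |
      0 ≤ p.1 ∧ p.2.2 ≤ C ∧ ∃ N, Attains Φ g h l K T B N p.1 p.2.1 p.2.2} := by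
  obtain ⟨M, hM⟩ := exists_nat_ge (C / l0)
  convert (finite_Iic M).isClosed_biUnion (fun N _ => isClosed_attains H hB C N) using 1
  ext ⟨t, x, c⟩
  simp only [mem_ofPred_eq, mem_iUnion, mem_Iic, exists_prop]
  constructor
  · rintro ⟨ht, hcC, N, ha⟩
    refine ⟨N, ?_, ht, hcC, ha⟩
    have h1 : (N : ℝ) ≤ C / l0 := (le_div_iff₀ H.l0_pos).2 ((ha.mul_le H ht).trans hcC)
    exact_mod_cast h1.trans hM
  · rintro ⟨N, _, ht, hcC, ha⟩
    exact ⟨ht, hcC, N, ha⟩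

/-- A control that ends in an open target can be used from nearby initial data at nearly the same
cost. -/
theorem Attains.eventually (H : ControlData Φ g h l K T l0) (hB : IsOpen B)
    (ha : Attains Φ g h l K T B N t x c) :
    ∀ ε > 0, ∀ᶠ q in 𝓝[{q : ℝ × E | q.1 ≤ T}] (t, x),
      ∃ c' < c + ε, Attains Φ g h l K T B N q.1 q.2 c' := by
  have hΦ := H.isFlow.continuous
  have hG := continuous_runCost H.isFlow H.continuous_g
  induction ha with
  | @coast t x htT hend =>
    intro ε hε
    have h1 : Continuous fun q : ℝ × E => Φ q.1 T q.2 :=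
      hΦ.comp (by fun_prop : Continuous fun q : ℝ × E => (q.1, T, q.2))
    have h2 : Continuous fun q : ℝ × E => runCost Φ g q.1 T q.2 + h (Φ q.1 T q.2) :=
      (hG.comp (by fun_prop : Continuous fun q : ℝ × E => (q.1, T, q.2))).add
        (H.continuous_h.comp h1)
    filter_upwards [self_mem_nhdsWithin,
      nhdsWithin_le_nhds (h1.continuousAt.eventually_mem (hB.mem_nhds hend)),
      nhdsWithin_le_nhds ((h2.tendsto (t, x)).eventually_lt_const
        (lt_add_of_pos_right _ hε))] with q hq hq1 hq2
    exact ⟨_, hq2, .coast hq hq1⟩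
  | @jump N t τ x ξ c htτ hξ hc ih =>
    intro ε hε
    -- The perturbed initial time may lie beyond `τ`; the impulse is then made at once, hence the
    -- time `max q.1 τ`.
    have e : Continuous fun q : ℝ × E => (q.1, max q.1 τ, q.2) := by fun_prop
    have h1 : Continuous fun q : ℝ × E => Φ q.1 (max q.1 τ) q.2 := hΦ.comp e
    have h2 : Continuous fun q : ℝ × E => runCost Φ g q.1 (max q.1 τ) q.2 +
        l (max q.1 τ) (Φ q.1 (max q.1 τ) q.2) ξ :=
      (hG.comp e).add (H.continuous_l.comp
        ((by fun_prop : Continuous fun q : ℝ × E => max q.1 τ).prodMk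
          (h1.prodMk continuous_const)))
    have h3 : Continuous fun q : ℝ × E => (max q.1 τ, Φ q.1 (max q.1 τ) q.2 + ξ) :=
      (by fun_prop : Continuous fun q : ℝ × E => max q.1 τ).prodMk (h1.add continuous_const)
    have hτT : τ ≤ T := hc.le
    have h4 : Filter.Tendsto (fun q : ℝ × E => (max q.1 τ, Φ q.1 (max q.1 τ) q.2 + ξ))
        (𝓝[{q : ℝ × E | q.1 ≤ T}] (t, x)) (𝓝[{q : ℝ × E | q.1 ≤ T}] (τ, Φ t τ x + ξ)) := by
      refine tendsto_nhdsWithin_iff.2 ⟨?_, ?_⟩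
      · have := (h3.tendsto (t, x)).mono_left (nhdsWithin_le_nhds (s := {q : ℝ × E | q.1 ≤ T}))
        simpa only [max_eq_right htτ] using this
      · filter_upwards [self_mem_nhdsWithin] with q hq
        exact max_le hq hτT
    have h5 := h2.tendsto (t, x)
    simp only [max_eq_right htτ] at h5
    filter_upwards [h4.eventually (ih (ε / 2) (half_pos hε)),
      nhdsWithin_le_nhds (h5.eventually_lt_const (lt_add_of_pos_right _ (half_pos hε)))]
      with q ⟨c', hc', hq⟩ hq2
    exact ⟨_, by linarith, .jump (le_max_left _ _) hξ hq⟩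

/-- If an impulse into `B` lowers the cost outside of `B`, a target containing `B` can be replaced
by `B`. -/
theorem Attains.improve (H : ControlData Φ g h l K T l0) {B' : Set E}
    (hB : ∀ y ∉ B, ∃ ξ ∈ K, y + ξ ∈ B ∧ h (y + ξ) + l T y ξ ≤ h y)
    (ha : Attains Φ g h l K T B' N t x c) :
    ∃ c' ≤ c, ∃ N', Attains Φ g h l K T B N' t x c' := by
  induction ha with
  | @coast t x htT _ =>
    by_cases hend : Φ t T x ∈ B
    · exact ⟨_, le_rfl, 0, .coast htT hend⟩
    · obtain ⟨ξ, hξ, hmem, hle⟩ := hB _ hend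
      refine ⟨_, ?_, 1, .jump htT hξ (.coast le_rfl (by rwa [H.isFlow.self]))⟩
      rw [runCost_self, H.isFlow.self]
      linarith
  | jump htτ hξ _ ih =>
    obtain ⟨c', hc', N', ha'⟩ := ih
    exact ⟨_, by linarith, N' + 1, .jump htτ hξ ha'⟩

/-- The initial uncontrolled phase of the control from `s` merges with the motion from `t` to `s`,
so the number of impulses does not change. -/
theorem Attains.coast_first (H : ControlData Φ g h l K T l0) (hts : t ≤ s)
    (ha : Attains Φ g h l K T B N s (Φ t s x) c) :
    Attains Φ g h l K T B N t x (runCost Φ g t s x + c) := by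
  have hadd := runCost_add H.isFlow H.continuous_g
  generalize hy : Φ t s x = y at ha
  cases ha with
  | coast hsT hend =>
    subst hy
    rw [← add_assoc, hadd, H.isFlow.comp]
    exact .coast (hts.trans hsT) (by rwa [H.isFlow.comp] at hend)
  | @jump _ _ τ _ _ _ hsτ hξ hc =>
    subst hy
    rw [H.isFlow.comp] at hc
    rw [← add_assoc, ← add_assoc, hadd, H.isFlow.comp]
    exact .jump (hts.trans hsτ) hξ hc

theorem Attains.jump_first (H : ControlData Φ g h l K T l0) (hξ : ξ ∈ K)
    (ha : Attains Φ g h l K T B N t (x + ξ) c) :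
    Attains Φ g h l K T B (N + 1) t x (l t x ξ + c) := by
  have ha' : Attains Φ g h l K T B N t (Φ t t x + ξ) c := by rwa [H.isFlow.self]
  have := Attains.jump le_rfl hξ ha'
  rwa [runCost_self, H.isFlow.self, zero_add] at this

/-- A control either starts with an immediate impulse or coasts for some time. -/
theorem Attains.jump_or_coast (H : ControlData Φ g h l K T l0) (htT : t < T)
    (ha : Attains Φ g h l K T B N t x c) :
    (∃ ξ ∈ K, ∃ c' N', c = l t x ξ + c' ∧ Attains Φ g h l K T B N' t (x + ξ) c') ∨
    ∃ s > t, s ≤ T ∧ ∀ r ∈ Icc t s, ∃ c', c = runCost Φ g t r x + c' ∧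
      Attains Φ g h l K T B N r (Φ t r x) c' := by
  have hadd := runCost_add H.isFlow H.continuous_g
  cases ha with
  | coast _ hend =>
    refine .inr ⟨T, htT, le_rfl, fun r hr => ⟨_, ?_, .coast hr.2 (by rwa [H.isFlow.comp])⟩⟩
    rw [← add_assoc, hadd, H.isFlow.comp]
  | @jump N' _ τ _ ξ c' htτ hξ hc =>
    rcases htτ.eq_or_lt with rfl | hlt
    · rw [runCost_self, H.isFlow.self, zero_add]
      rw [H.isFlow.self] at hc
      exact .inl ⟨ξ, hξ, c', _, rfl, hc⟩
    · refine .inr ⟨τ, hlt, hc.le, fun r hr =>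
        ⟨_, ?_, .jump hr.2 hξ (by rwa [H.isFlow.comp])⟩⟩
      rw [← add_assoc, ← add_assoc, hadd, H.isFlow.comp]

/-- At the terminal time several impulses can be replaced by their sum. -/
theorem Attains.terminal (H : ControlData Φ g h l K T l0)
    (hK : ∀ ξ ∈ K, ∀ ξ' ∈ K, ξ + ξ' ∈ K)
    (hsub : ∀ x, ∀ ξ ∈ K, ∀ ξ' ∈ K, l T x (ξ + ξ') ≤ l T x ξ + l T (x + ξ) ξ')
    (ha : Attains Φ g h l K T B N t x c) (ht : t = T) :
    (x ∈ B ∧ h x ≤ c) ∨ ∃ ξ ∈ K, x + ξ ∈ B ∧ h (x + ξ) + l T x ξ ≤ c := by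
  induction ha with
  | @coast t x _ hend =>
    subst ht
    rw [H.isFlow.self] at hend ⊢
    rw [runCost_self]
    exact .inl ⟨hend, by simp⟩
  | @jump N t τ x ξ c htτ hξ hc ih =>
    subst ht
    obtain rfl : t = τ := le_antisymm htτ hc.le
    rw [runCost_self, H.isFlow.self]
    rw [H.isFlow.self] at ih
    rcases ih rfl with ⟨h1, h2⟩ | ⟨ξ', hξ', h1, h2⟩
    · exact .inr ⟨ξ, hξ, h1, by linarith⟩
    · refine .inr ⟨ξ + ξ', hK _ hξ _ hξ', by rwa [← add_assoc], ?_⟩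
      have := hsub x ξ hξ ξ' hξ'
      rw [← add_assoc]
      linarith

end Attains

/-! ### Optimal controls, continuity of the value, dynamic programming. -/

section ValueFunction

variable {E : Type*} [NormedAddCommGroup E] {Φ : ℝ → ℝ → E → E} {g : ℝ → E → ℝ} {h : E → ℝ}
  {l : ℝ → E → E → ℝ} {K : Set E} {T l0 : ℝ} {B D : Set E} {V : ℝ → E → ℝ} {t : ℝ} {x : E}

/-- Coasting to `T` and jumping into `B` gives a finite cost `C`; the attainable costs up to `C`
form a closed set bounded below by `0`. -/
theorem exists_isLeast_attains [ProperSpace E] (H : ControlData Φ g h l K T l0) (hB : IsClosed B)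
    (ht : t ∈ Icc 0 T) (hK : ∀ y, ∃ ξ ∈ K, y + ξ ∈ B) (x : E) :
    ∃ v, IsLeast {c | ∃ N, Attains Φ g h l K T B N t x c} v := by
  obtain ⟨ξ, hξ, hmem⟩ := hK (Φ t T x)
  have hC := Attains.jump (g := g) (h := h) (l := l) ht.2 hξ
    (.coast le_rfl (by rwa [H.isFlow.self] : Φ T T (Φ t T x + ξ) ∈ B))
  generalize runCost Φ g t T x + l T (Φ t T x) ξ + _ = C at hC
  have hcl : IsClosed {c | 0 ≤ t ∧ c ≤ C ∧ ∃ N, Attains Φ g h l K T B N t x c} :=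
    (isClosed_exists_attains H hB C).preimage
      (by fun_prop : Continuous fun c : ℝ => (t, x, c))
  have hl := hcl.isLeast_csInf ⟨C, ht.1, le_rfl, _, hC⟩
    ⟨0, fun c hc => hc.2.2.choose_spec.nonneg H ht.1⟩
  refine ⟨_, hl.1.2.2, fun c hc => ?_⟩
  rcases le_total c C with hcC | hcC
  · exact hl.2 ⟨ht.1, hcC, hc⟩
  · exact hl.1.2.1.trans hcC

theorem continuousOn_value [ProperSpace E] (H : ControlData Φ g h l K T l0) (hD : IsOpen D)
    (hcompat : ∀ y ∉ D, ∃ ξ ∈ K, y + ξ ∈ D ∧ h (y + ξ) + l T y ξ ≤ h y)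
    (hV : ∀ t ∈ Icc 0 T, ∀ x, IsLeast {c | ∃ N, Attains Φ g h l K T (closure D) N t x c} (V t x)) :
    ContinuousOn (fun p : ℝ × E => V p.1 p.2) (Icc 0 T ×ˢ univ) := by
  rintro ⟨t, x⟩ ⟨ht, -⟩
  refine tendsto_order.2 ⟨fun a ha => ?_, fun a ha => ?_⟩
  -- Lower semicontinuity: the points from which some cost in `[0, a]` is attainable form a closed
  -- set, and it misses `(t, x)`.
  · have hF := isClosed_setOf_exists_mem_compact (X := ℝ × E) (isCompact_Icc (a := (0 : ℝ)) (b := a))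
      ((isClosed_exists_attains H (isClosed_closure (s := D)) a).preimage
        (by fun_prop : Continuous fun q : (ℝ × E) × ℝ => (q.1.1, q.1.2, q.2)))
    have hnhds := hF.isOpen_compl.mem_nhds (x := (t, x)) (by
      rintro ⟨c, hc, -, -, hN⟩
      exact absurd ((hV t ht x).2 hN) (not_le.2 (hc.2.trans_lt ha)))
    filter_upwards [self_mem_nhdsWithin, nhdsWithin_le_nhds hnhds]
      with q hq hq'
    by_contra hle
    obtain ⟨N, hN⟩ := (hV q.1 hq.1 q.2).1
    exact hq' ⟨V q.1 q.2, ⟨hN.nonneg H hq.1.1, not_lt.1 hle⟩, hq.1.1, not_lt.1 hle, N, hN⟩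
  -- Upper semicontinuity: redirect an optimal control into the open set `D`, then use it from
  -- nearby initial data.
  · obtain ⟨N, hN⟩ := (hV t ht x).1
    obtain ⟨c, hc, N', hN'⟩ := hN.improve H hcompat
    have hev := hN'.eventually H hD (a - V t x) (sub_pos.2 ha)
    have hsub : Icc 0 T ×ˢ univ ⊆ {q : ℝ × E | q.1 ≤ T} := fun q hq => hq.1.2
    filter_upwards [self_mem_nhdsWithin, nhdsWithin_mono _ hsub hev] with q hq ⟨c', hc', hq'⟩
    have := (hV q.1 hq.1 q.2).2 ⟨N', hq'.mono subset_closure⟩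
    dsimp only at ha
    linarith

theorem value_le_coast (H : ControlData Φ g h l K T l0)
    (hV : ∀ t ∈ Icc 0 T, ∀ x, IsLeast {c | ∃ N, Attains Φ g h l K T B N t x c} (V t x))
    {s : ℝ} (ht : t ∈ Icc 0 T) (hts : t ≤ s) (hs : s ≤ T) :
    V t x ≤ runCost Φ g t s x + V s (Φ t s x) := by
  obtain ⟨N, hN⟩ := (hV s ⟨ht.1.trans hts, hs⟩ (Φ t s x)).1
  exact (hV t ht x).2 ⟨N, hN.coast_first H hts⟩

theorem value_le_jump (H : ControlData Φ g h l K T l0)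
    (hV : ∀ t ∈ Icc 0 T, ∀ x, IsLeast {c | ∃ N, Attains Φ g h l K T B N t x c} (V t x))
    (ht : t ∈ Icc 0 T) {ξ : E} (hξ : ξ ∈ K) : V t x ≤ V t (x + ξ) + l t x ξ := by
  obtain ⟨N, hN⟩ := (hV t ht (x + ξ)).1
  rw [add_comm]
  exact (hV t ht x).2 ⟨N + 1, hN.jump_first H hξ⟩

/-- Where no immediate impulse is optimal, it is optimal to coast for some time. -/
theorem coast_le_value (H : ControlData Φ g h l K T l0)
    (hV : ∀ t ∈ Icc 0 T, ∀ x, IsLeast {c | ∃ N, Attains Φ g h l K T B N t x c} (V t x))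
    (ht : t ∈ Ico 0 T) (hlt : ∀ ξ ∈ K, V t x < V t (x + ξ) + l t x ξ) :
    ∃ s > t, s ≤ T ∧ ∀ r ∈ Icc t s, runCost Φ g t r x + V r (Φ t r x) ≤ V t x := by
  have ht' : t ∈ Icc 0 T := Ico_subset_Icc_self ht
  obtain ⟨N, hN⟩ := (hV t ht' x).1
  rcases hN.jump_or_coast H ht.2 with ⟨ξ, hξ, c, N', hc, ha⟩ | ⟨s, hs, hsT, hr⟩
  · have h1 := (hV t ht' (x + ξ)).2 ⟨N', ha⟩
    exact absurd (hlt ξ hξ) (by linarith)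
  · refine ⟨s, hs, hsT, fun r hr' => ?_⟩
    obtain ⟨c', hc', ha⟩ := hr r hr'
    have := (hV r ⟨ht.1.trans hr'.1, hr'.2.trans hsT⟩ _).2 ⟨N, ha⟩
    linarith

/-- A coercive continuous function attains its minimum on a closed set of impulses. -/
theorem exists_forall_le_of_coercive [ProperSpace E] (H : ControlData Φ g h l K T l0)
    (ht : t ∈ Icc 0 T) {F : E → ℝ} (hF : Continuous F) {S : Set E} (hS : IsClosed S)
    (hSK : S ⊆ K) (hne : S.Nonempty) (hle : ∀ ξ ∈ S, l t x ξ ≤ F ξ) :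
    ∃ ξ ∈ S, ∀ ξ' ∈ S, F ξ ≤ F ξ' := by
  obtain ⟨ξ0, h0⟩ := hne
  obtain ⟨R, hR⟩ := H.coercive (F ξ0)
  have hball : ∀ ξ ∈ S, F ξ ≤ F ξ0 → ξ ∈ S ∩ Metric.closedBall 0 R := fun ξ hξ hle' =>
    ⟨hξ, mem_closedBall_zero_iff.2 (hR t ht x ξ (hSK hξ) ((hle ξ hξ).trans hle'))⟩
  obtain ⟨ξ, hξ, hmin⟩ := ((isCompact_closedBall (0 : E) R).inter_left hS).exists_isMinOn
    ⟨ξ0, hball ξ0 h0 le_rfl⟩ hF.continuousOn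
  refine ⟨ξ, hξ.1, fun ξ' hξ' => ?_⟩
  rcases le_total (F ξ') (F ξ0) with h1 | h1
  · exact hmin (hball ξ' hξ' h1)
  · exact (hmin (hball ξ0 h0 le_rfl)).trans h1

end ValueFunction

/-! ### Test functions along the flow. -/

section Viscosity

variable {n : ℕ} {T : ℝ} {Φ : ℝ → ℝ → State n → State n} {f : ℝ → State n → State n}
  {g : ℝ → State n → ℝ} {φ : ℝ → State n → ℝ} {t : ℝ} {x : State n}

/-- The derivative of a test function plus running cost along an uncontrolled motion. -/
theorem hasDerivWithinAt_hamiltonian (hΦ : IsFlow Φ)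
    (hcurve : ∀ t x, IsIntegralCurveOn (fun s => Φ t s x) f (Icc 0 T))
    (hg : Continuous fun p : ℝ × State n => g p.1 p.2) (ht : t ∈ Ico 0 T)
    (hφ : ContDiffOn ℝ 1 (fun p : ℝ × State n => φ p.1 p.2) (strip n T)) :
    HasDerivWithinAt (fun s => φ s (Φ t s x) + runCost Φ g t s x) (hamiltonian T f g φ t x)
      (Ioi t) t := by
  have ht' : t ∈ Icc 0 T := Ico_subset_Icc_self ht
  have hu : UniqueDiffWithinAt ℝ (Icc 0 T) t := uniqueDiffOn_Icc (ht.1.trans_lt ht.2) t ht'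
  -- One derivative `A` within the strip serves for all: its values along the motion, in time alone
  -- and in space alone come from the chain rule. The strip is full in space, so the spatial
  -- derivative is unrestricted.
  obtain ⟨A, hA⟩ := (hφ.differentiableOn one_ne_zero) (t, x) ⟨ht', mem_univ _⟩
  have d1 : HasDerivWithinAt (fun s => φ s (Φ t s x)) (A (1, f t x)) (Icc 0 T) t := by
    have hc : HasDerivWithinAt (fun s => (s, Φ t s x)) (1, f t x) (Icc 0 T) t := by
      have := (hasDerivWithinAt_id t (Icc 0 T)).prodMk (hcurve t x t ht')
      simp only [hΦ.self] at this
      exact this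
    have hm : MapsTo (fun s => (s, Φ t s x)) (Icc 0 T) (strip n T) := fun s hs => ⟨hs, mem_univ _⟩
    exact hA.comp_hasDerivWithinAt_of_eq t hc hm (by rw [hΦ.self])
  have d2 : derivWithin (fun s => φ s x) (Icc 0 T) t = A (1, 0) := by
    have hc : HasDerivWithinAt (fun s => (s, x)) (1, 0) (Icc 0 T) t :=
      (hasDerivWithinAt_id t (Icc 0 T)).prodMk (hasDerivWithinAt_const t (Icc 0 T) x)
    have hm : MapsTo (fun s => (s, x)) (Icc 0 T) (strip n T) := fun s hs => ⟨hs, mem_univ _⟩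
    exact (hA.comp_hasDerivWithinAt t hc hm).derivWithin hu
  have d3 : HasFDerivAt (φ t) (A.comp (ContinuousLinearMap.inr ℝ ℝ (State n))) x := by
    have hc : HasFDerivWithinAt (fun y : State n => (t, y)) (ContinuousLinearMap.inr ℝ ℝ (State n))
      univ x := (hasFDerivAt_prodMk_right t x).hasFDerivWithinAt
    exact hasFDerivWithinAt_univ.1 (hA.comp x hc
      (fun y _ => ⟨ht', mem_univ _⟩ : MapsTo (fun y => (t, y)) univ (strip n T)))
  have d4 : HasDerivAt (fun s => runCost Φ g t s x) (g t x) t := by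
    have hc := continuous_running hΦ hg t x
    have := intervalIntegral.integral_hasDerivAt_right (hc.intervalIntegrable (μ := volume) t t)
      hc.stronglyMeasurable.stronglyMeasurableAtFilter hc.continuousAt
    simp only [hΦ.self] at this
    exact this
  have hham : hamiltonian T f g φ t x = A (1, f t x) + g t x := by
    have e : ((1 : ℝ), f t x) = (1, 0) + (0, f t x) := by simp
    rw [hamiltonian, d2, e, map_add, gradient, InnerProductSpace.toDual_symm_apply, d3.fderiv]
    rfl
  rw [hham]
  have d1' := d1.mono_of_mem_nhdsWithin (Icc_mem_nhdsGT_of_mem ht)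
  exact d1'.add d4.hasDerivWithinAt

theorem nonneg_of_hasDerivWithinAt_Ioi {ψ : ℝ → ℝ} {d : ℝ} (hd : HasDerivWithinAt ψ d (Ioi t) t)
    (hle : ∀ᶠ s in 𝓝[>] t, ψ t ≤ ψ s) : 0 ≤ d := by
  refine ge_of_tendsto ((hasDerivWithinAt_iff_tendsto_slope' self_notMem_Ioi).1 hd) ?_
  filter_upwards [hle, self_mem_nhdsWithin] with s hs hts
  rw [slope_def_field]
  exact div_nonneg (sub_nonneg.2 hs) (sub_nonneg.2 (mem_Ioi.1 hts).le)

theorem tendsto_motion (hΦ : IsFlow Φ) (ht : t ∈ Ico 0 T) :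
    Filter.Tendsto (fun s => (s, Φ t s x)) (𝓝[>] t) (𝓝[strip n T] (t, x)) := by
  refine tendsto_nhdsWithin_iff.2 ⟨?_, ?_⟩
  · have hc : Continuous fun s => (s, Φ t s x) := continuous_id.prodMk (hΦ.continuous.comp
      (continuous_const.prodMk (continuous_id.prodMk continuous_const)))
    have := (hc.tendsto t).mono_left (nhdsWithin_le_nhds (s := Ioi t))
    simpa only [hΦ.self] using this
  · filter_upwards [Icc_mem_nhdsGT_of_mem ht] with s hs
    exact ⟨hs, mem_univ _⟩

/-- Along the motion the maximum makes `φ` increase at least as much as `V`, and `V` drops by at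
most the running cost. So `φ` plus running cost is smallest at `t`, and its right derivative is
non-negative. -/
theorem hamiltonian_nonneg_of_isLocalMaxOn {V : ℝ → State n → ℝ} (hΦ : IsFlow Φ)
    (hcurve : ∀ t x, IsIntegralCurveOn (fun s => Φ t s x) f (Icc 0 T))
    (hg : Continuous fun p : ℝ × State n => g p.1 p.2) (ht : t ∈ Ico 0 T)
    (hφ : ContDiffOn ℝ 1 (fun p : ℝ × State n => φ p.1 p.2) (strip n T))
    (hmax : IsLocalMaxOn (fun p : ℝ × State n => V p.1 p.2 - φ p.1 p.2) (strip n T) (t, x))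
    (hV : ∀ᶠ s in 𝓝[>] t, V t x ≤ runCost Φ g t s x + V s (Φ t s x)) :
    0 ≤ hamiltonian T f g φ t x := by
  refine nonneg_of_hasDerivWithinAt_Ioi (hasDerivWithinAt_hamiltonian hΦ hcurve hg ht hφ) ?_
  filter_upwards [(tendsto_motion hΦ ht).eventually hmax, hV] with s h1 h2
  rw [hΦ.self, runCost_self]
  linarith

theorem hamiltonian_nonpos_of_isLocalMinOn {V : ℝ → State n → ℝ} (hΦ : IsFlow Φ)
    (hcurve : ∀ t x, IsIntegralCurveOn (fun s => Φ t s x) f (Icc 0 T))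
    (hg : Continuous fun p : ℝ × State n => g p.1 p.2) (ht : t ∈ Ico 0 T)
    (hφ : ContDiffOn ℝ 1 (fun p : ℝ × State n => φ p.1 p.2) (strip n T))
    (hmin : IsLocalMinOn (fun p : ℝ × State n => V p.1 p.2 - φ p.1 p.2) (strip n T) (t, x))
    (hV : ∀ᶠ s in 𝓝[>] t, runCost Φ g t s x + V s (Φ t s x) ≤ V t x) :
    hamiltonian T f g φ t x ≤ 0 := by
  refine neg_nonneg.1 (nonneg_of_hasDerivWithinAt_Ioi
    (hasDerivWithinAt_hamiltonian hΦ hcurve hg ht hφ).neg ?_)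
  filter_upwards [(tendsto_motion hΦ ht).eventually hmin, hV] with s h1 h2
  simp only [Pi.neg_apply, hΦ.self, runCost_self]
  linarith

end Viscosity

/-- Left limits are determined by the values to the left and at the point. -/
theorem leftLim_congr {E : Type*} [TopologicalSpace E] [T2Space E] {X Y : ℝ → E} {a : ℝ}
    (h : X =ᶠ[𝓝[<] a] Y) (ha : X a = Y a) : Function.leftLim X a = Function.leftLim Y a := by
  by_cases hex : ∃ y, Filter.Tendsto X (𝓝[<] a) (𝓝 y)
  · obtain ⟨y, hy⟩ := hex
    rw [leftLim_eq_of_tendsto hy, leftLim_eq_of_tendsto (hy.congr' h)]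
  · have hex' : ¬∃ y, Filter.Tendsto Y (𝓝[<] a) (𝓝 y) :=
      fun ⟨y, hy⟩ => hex ⟨y, hy.congr' h.symm⟩
    rw [leftLim_eq_of_not_tendsto _ hex, leftLim_eq_of_not_tendsto _ hex', ha]

/-- `Φ` is the flow on `[0, T]` of the drift `f`, which is continuous and Lipschitz in space. -/
structure IsDriftFlow {n : ℕ} (T : ℝ) (f : ℝ → State n → State n)
    (Φ : ℝ → ℝ → State n → State n) : Prop extends IsFlow Φ where
  curve : ∀ t x, IsIntegralCurveOn (fun s => Φ t s x) f (Icc 0 T)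
  lipschitz : ∃ κ : NNReal, ∀ r ∈ Icc 0 T, LipschitzWith κ (f r)
  continuousOn : ContinuousOn (Function.uncurry f) (strip n T)

/-! ### Trajectories of impulse controls correspond to attainable costs. -/

section Trajectory

variable {n : ℕ} {K : ProperCone ℝ (State n)} {T t τ s : ℝ} {f : ℝ → State n → State n}
  {Φ : ℝ → ℝ → State n → State n} {x ξ : State n} {X X' : ℝ → State n}

/-- Prepend one impulse to a control. -/
def ImpulseControl.cons (u : ImpulseControl K τ T) (ht : t ≤ τ) (hτ : τ ≤ T) (hξ : ξ ∈ K) :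
    ImpulseControl K t T where
  N := u.N + 1
  time := Fin.cons τ u.time
  impulse := Fin.cons ξ u.impulse
  time_mono := by
    intro i j hij
    induction j using Fin.cases with
    | zero => rw [Fin.le_zero_iff.1 hij]
    | succ j =>
      induction i using Fin.cases with
      | zero => simpa using (u.time_mem j).1
      | succ i => simpa using u.time_mono (Fin.succ_le_succ_iff.1 hij)
  time_mem := by
    intro i
    induction i using Fin.cases with
    | zero => exact ⟨ht, hτ⟩
    | succ i => exact ⟨ht.trans (u.time_mem i).1, (u.time_mem i).2⟩
  impulse_mem := by
    intro i
    induction i using Fin.cases with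
    | zero => exact hξ
    | succ i => exact u.impulse_mem i

theorem ImpulseControl.exists_eq_cons {N : ℕ} (u : ImpulseControl K t T) (hN : u.N = N + 1) :
    ∃ (τ : ℝ) (ξ : State n) (ht : t ≤ τ) (hτ : τ ≤ T) (hξ : ξ ∈ K) (u' : ImpulseControl K τ T),
      u'.N = N ∧ u = u'.cons ht hτ hξ := by
  obtain ⟨M, time, impulse, hmono, hmem, himp⟩ := u
  obtain rfl : M = N + 1 := hN
  refine ⟨time 0, impulse 0, (hmem 0).1, (hmem 0).2, himp 0,
    ⟨N, Fin.tail time, Fin.tail impulse, fun i j hij => hmono (Fin.succ_le_succ_iff.2 hij),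
      fun k => ⟨hmono (Fin.zero_le _), (hmem k.succ).2⟩, fun k => himp k.succ⟩, rfl, ?_⟩
  simp only [ImpulseControl.cons, Fin.cons_self_tail]

theorem ImpulseControl.path_cons (u : ImpulseControl K τ T) (ht : t ≤ τ) (hτ : τ ≤ T)
    (hξ : ξ ∈ K) (s : ℝ) :
    (u.cons ht hτ hξ).path s = (Icc τ T).indicator (fun _ => ξ) s + u.path s := by
  simp only [ImpulseControl.path]
  exact Fin.sum_univ_succ _

theorem ImpulseControl.path_eq_zero (u : ImpulseControl K t T) (hs : ∀ k, s < u.time k) :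
    u.path s = 0 :=
  Finset.sum_eq_zero fun k _ => indicator_of_notMem (fun h => absurd (hs k) (not_lt.2 h.1)) _

theorem IsDriftFlow.continuous_drift (hΦ : IsDriftFlow T f Φ) (t : ℝ) (x : State n) :
    ContinuousOn (fun r => f r (Φ t r x)) (Icc 0 T) :=
  ODE.continuousOn_comp hΦ.continuousOn (hΦ.curve t x).continuousOn fun _ _ => mem_univ _

theorem IsDriftFlow.integral_eq (hΦ : IsDriftFlow T f Φ) (ht : t ∈ Icc 0 T) (hs : s ∈ Icc 0 T)
    (x : State n) : x + ∫ r in t..s, f r (Φ t r x) = Φ t s x := by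
  have hsub : uIcc t s ⊆ Icc 0 T := uIcc_subset_Icc ht hs
  have := ODE.picard_eq_of_hasDerivAt (α := fun r => Φ t r x) (t₀ := t) (t := s) (u := univ)
    (hΦ.continuousOn.mono (prod_mono_left hsub))
    (fun r hr => (hΦ.curve t x r (hsub hr)).mono hsub) (fun _ _ => mem_univ _)
  simpa only [ODE.picard_apply, hΦ.self] using this

/-- Before the first impulse a trajectory follows the flow. -/
theorem IsTrajectory.eq_flow {u : ImpulseControl K t T} (hX : IsTrajectory f x u X)
    (hΦ : IsDriftFlow T f Φ) (ht : 0 ≤ t) (htτ : t ≤ τ) (hτ : τ ≤ T) (hu : ∀ k, τ ≤ u.time k) :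
    (∀ s ∈ Ico t τ, X s = Φ t s x) ∧ x + (∫ r in t..τ, f r (X r)) = Φ t τ x := by
  have hsub : Icc t τ ⊆ Icc 0 T := Icc_subset_Icc ht hτ
  -- `Y` is `X` without impulses. They agree on `[t, τ)` but perhaps not at `τ`, which the integral
  -- does not see; so `Y` is a fixed point of the Picard operator, and uniqueness identifies it with
  -- the flow.
  set Y : ℝ → State n := fun s => x + ∫ r in t..s, f r (X r)
  have hXY : ∀ s ∈ Ico t τ, X s = Y s := fun s hs => by
    rw [hX.eqn s ⟨hs.1, hs.2.le.trans hτ⟩, u.path_eq_zero fun k => hs.2.trans_le (hu k), add_zero]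
  have hYc : ContinuousOn Y (Icc t τ) := by
    have := intervalIntegral.continuousOn_primitive_interval' hX.integrable left_mem_uIcc
    rw [uIcc_of_le (htτ.trans hτ)] at this
    exact continuousOn_const.add (this.mono (Icc_subset_Icc_right hτ))
  have hYeq : ∀ s ∈ Icc t τ, Y s = ODE.picard f t x Y s := fun s hs => by
    rw [ODE.picard_apply]
    refine congrArg (x + ·) (intervalIntegral.integral_congr_Ioo_of_le hs.1 fun r hr => ?_)
    rw [hXY r ⟨hr.1.le, hr.2.trans_le hs.2⟩]
  have hYcurve : IsIntegralCurveOn Y f (Icc t τ) := fun s hs =>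
    (ODE.hasDerivWithinAt_picard_Icc (u := univ) ⟨le_rfl, htτ⟩
      (hΦ.continuousOn.mono (prod_mono_left hsub)) hYc (fun _ _ => mem_univ _) x hs).congr_of_mem
      hYeq hs
  obtain ⟨κ, hκ⟩ := hΦ.lipschitz
  have heq : EqOn Y (fun s => Φ t s x) (Icc t τ) :=
    eqOn_of_isIntegralCurveOn (fun r hr => hκ r (hsub hr)) hYcurve ((hΦ.curve t x).mono hsub)
      ⟨le_rfl, htτ⟩ (by simp [Y, hΦ.self])
  exact ⟨fun s hs => (hXY s hs).trans (heq (Ico_subset_Icc_self hs)), heq ⟨htτ, le_rfl⟩⟩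

theorem IsTrajectory.leftLim_eq {u : ImpulseControl K t T} (hX : IsTrajectory f x u X)
    (hΦ : IsDriftFlow T f Φ) (ht : 0 ≤ t) (htτ : t ≤ τ) (hτ : τ ≤ T) (hu : ∀ k, τ ≤ u.time k) :
    Function.leftLim X τ = Φ t τ x := by
  rcases htτ.eq_or_lt with rfl | hlt
  -- For an impulse at the initial time the left limit is `x`, because `X` is set to `x` before `t`.
  · rw [hΦ.self]
    refine leftLim_eq_of_tendsto (tendsto_const_nhds.congr' ?_)
    filter_upwards [self_mem_nhdsWithin] with s hs using (hX.before s hs).symm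
  · have hc : Continuous fun s => Φ t s x := hΦ.continuous.comp
      (continuous_const.prodMk (continuous_id.prodMk continuous_const))
    refine leftLim_eq_of_tendsto (((hc.tendsto τ).mono_left nhdsWithin_le_nhds).congr' ?_)
    filter_upwards [Ico_mem_nhdsLT hlt] with s hs
    exact ((hX.eq_flow hΦ ht htτ hτ hu).1 s hs).symm

theorem ImpulseControl.le_time_cons (u : ImpulseControl K τ T) (ht : t ≤ τ) (hτ : τ ≤ T)
    (hξ : ξ ∈ K) (k : Fin (u.cons ht hτ hξ).N) : τ ≤ (u.cons ht hτ hξ).time k :=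
  (u.cons ht hτ hξ).time_mono (Fin.zero_le (n := u.N + 1) k)

/-- After its first impulse a trajectory is a trajectory of the remaining control. -/
theorem IsTrajectory.tail {u : ImpulseControl K τ T} {ht : t ≤ τ} {hτ : τ ≤ T} {hξ : ξ ∈ K}
    (hX : IsTrajectory f x (u.cons ht hτ hξ) X) (hΦ : IsDriftFlow T f Φ) (ht0 : 0 ≤ t) :
    IsTrajectory f (Φ t τ x + ξ) u (fun s => if s < τ then Φ t τ x + ξ else X s) := by
  have hflow := (hX.eq_flow hΦ ht0 ht hτ (u.le_time_cons ht hτ hξ)).2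
  have hint : IntervalIntegrable (fun r => f r (X r)) volume τ T := hX.integrable.mono_set (by
    rw [uIcc_of_le hτ, uIcc_of_le (ht.trans hτ)]; exact Icc_subset_Icc_left ht)
  have hint' : IntervalIntegrable (fun r => f r (X r)) volume t τ := hX.integrable.mono_set (by
    rw [uIcc_of_le ht, uIcc_of_le (ht.trans hτ)]; exact Icc_subset_Icc_right hτ)
  have hgt : ∀ r, τ ≤ r → (if r < τ then Φ t τ x + ξ else X r) = X r :=
    fun r hr => if_neg (not_lt.2 hr)
  refine ⟨fun s hs => if_pos hs, hint.congr fun r hr => ?_, fun s hs => ?_⟩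
  · rw [uIoc_of_le hτ] at hr
    simp only [hgt r hr.1.le]
  · have e : ∫ r in τ..s, f r (if r < τ then Φ t τ x + ξ else X r) = ∫ r in τ..s, f r (X r) :=
      intervalIntegral.integral_congr fun r hr => by
        rw [uIcc_of_le hs.1] at hr
        simp only [hgt r hr.1]
    have hint'' : IntervalIntegrable (fun r => f r (X r)) volume τ s := hint.mono_set (by
      rw [uIcc_of_le hτ, uIcc_of_le hs.1]; exact Icc_subset_Icc_right hs.2)
    rw [hgt s hs.1, e, hX.eqn s ⟨ht.trans hs.1, hs.2⟩, ImpulseControl.path_cons,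
      indicator_of_mem hs, ← hflow,
      ← intervalIntegral.integral_add_adjacent_intervals hint' hint'']
    abel

/-- Prepending an impulse to the control of a trajectory. -/
theorem IsTrajectory.exists_cons {u : ImpulseControl K τ T} (ht : t ≤ τ) (hτ : τ ≤ T)
    (hξ : ξ ∈ K) (hX' : IsTrajectory f (Φ t τ x + ξ) u X') (hΦ : IsDriftFlow T f Φ)
    (ht0 : 0 ≤ t) :
    ∃ X, IsTrajectory f x (u.cons ht hτ hξ) X ∧ ∀ s, τ ≤ s → X s = X' s := by
  set X : ℝ → State n := fun s => if s < t then x else if s < τ then Φ t s x else X' s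
  have hgt : ∀ s, τ ≤ s → X s = X' s := fun s hs => by
    simp only [X, if_neg (not_lt.2 hs), if_neg (not_lt.2 (ht.trans hs))]
  have hmid : ∀ s, t ≤ s → s < τ → X s = Φ t s x := fun s h1 h2 => by
    simp only [X, if_neg (not_lt.2 h1), if_pos h2]
  have htI : t ∈ Icc 0 T := ⟨ht0, ht.trans hτ⟩
  have hτI : τ ∈ Icc 0 T := ⟨ht0.trans ht, hτ⟩
  have hint1 : IntervalIntegrable (fun r => f r (X r)) volume t τ := by
    have h1 : IntervalIntegrable (fun r => f r (Φ t r x)) volume t τ :=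
      ((hΦ.continuous_drift t x).mono (uIcc_subset_Icc htI hτI)).intervalIntegrable
    refine h1.congr_uIoo fun r hr => ?_
    rw [uIoo_of_le ht] at hr
    simp only [hmid r hr.1.le hr.2]
  have hint2 : IntervalIntegrable (fun r => f r (X r)) volume τ T :=
    hX'.integrable.congr fun r hr => by
      rw [uIoc_of_le hτ] at hr
      simp only [hgt r hr.1.le]
  have hhead : ∀ s ∈ Icc t τ, x + ∫ r in t..s, f r (X r) = Φ t s x := fun s hs => by
    rw [← hΦ.integral_eq htI ⟨ht0.trans hs.1, hs.2.trans hτ⟩ x]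
    refine congrArg (x + ·) (intervalIntegral.integral_congr_Ioo_of_le hs.1 fun r hr => ?_)
    simp only [hmid r hr.1.le (hr.2.trans_le hs.2)]
  refine ⟨X, ⟨fun s hs => if_pos hs, hint1.trans hint2, fun s hs => ?_⟩, hgt⟩
  rcases lt_or_ge s τ with hlt | hle
  · rw [hhead s ⟨hs.1, hlt.le⟩, hmid s hs.1 hlt, ImpulseControl.path_eq_zero _
      fun k => hlt.trans_le (u.le_time_cons ht hτ hξ k), add_zero]
  · have hint3 : IntervalIntegrable (fun r => f r (X r)) volume τ s := hint2.mono_set (by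
      rw [uIcc_of_le hτ, uIcc_of_le hle]; exact Icc_subset_Icc_right hs.2)
    have e : ∫ r in τ..s, f r (X r) = ∫ r in τ..s, f r (X' r) :=
      intervalIntegral.integral_congr fun r hr => by
        rw [uIcc_of_le hle] at hr
        simp only [hgt r hr.1]
    have hsI : s ∈ Icc τ T := ⟨hle, hs.2⟩
    rw [hgt s hle, hX'.eqn s hsI, ImpulseControl.path_cons, indicator_of_mem hsI,
      ← intervalIntegral.integral_add_adjacent_intervals hint1 hint3, ← hhead τ ⟨ht, le_rfl⟩, e]
    abel

variable {g : ℝ → State n → ℝ} {h : State n → ℝ} {l : ℝ → State n → State n → ℝ}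

/-- The states before the later impulses do not depend on the first one having been split off. -/
theorem stateBefore_cons_succ {u : ImpulseControl K τ T} {ht : t ≤ τ} {hτ : τ ≤ T} {hξ : ξ ∈ K}
    (hX : IsTrajectory f x (u.cons ht hτ hξ) X) (hX' : IsTrajectory f (Φ t τ x + ξ) u X')
    (heq : ∀ s, τ ≤ s → X s = X' s) (hΦ : IsDriftFlow T f Φ) (ht0 : 0 ≤ t) (k : Fin u.N) :
    stateBefore (u.cons ht hτ hξ) X (Fin.succ k) = stateBefore u X' k := by
  let k' : Fin (u.cons ht hτ hξ).N := Fin.succ k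
  have hsum : (∑ j with j < k' ∧ (u.cons ht hτ hξ).time j = (u.cons ht hτ hξ).time k',
        (u.cons ht hτ hξ).impulse j) =
      (if τ = u.time k then ξ else 0) +
        ∑ j with j < k ∧ u.time j = u.time k, u.impulse j := by
    rw [Finset.sum_filter, Finset.sum_filter]
    refine (Fin.sum_univ_succ (n := u.N) _).trans ?_
    congr 1
    · exact if_congr (and_iff_right (Fin.succ_pos k)) rfl rfl
    · exact Finset.sum_congr rfl fun j _ =>
        if_congr (and_congr_left' Fin.succ_lt_succ_iff) rfl rfl
  have htime : (u.cons ht hτ hξ).time k' = u.time k := rfl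
  change Function.leftLim X ((u.cons ht hτ hξ).time k') + _ = _
  rw [hsum, stateBefore, htime, ← add_assoc]
  congr 1
  -- If the later impulse also happens at `τ`, then `X` has left limit `Φ t τ x` and the first
  -- impulse `ξ` is in the sum; `X'` instead starts from `Φ t τ x + ξ`. If it happens later, `ξ` is
  -- already in both left limits.
  rcases (u.time_mem k).1.eq_or_lt with he | hlt
  · rw [if_pos he, ← he, hX.leftLim_eq hΦ ht0 ht hτ (u.le_time_cons ht hτ hξ),
      hX'.leftLim_eq hΦ (ht0.trans ht) le_rfl hτ fun k => (u.time_mem k).1, hΦ.self]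
  · rw [if_neg hlt.ne, add_zero]
    refine leftLim_congr ?_ (heq _ hlt.le)
    filter_upwards [Ico_mem_nhdsLT hlt] with s hs using heq s hs.1

/-- Mirrors the `jump` rule of `Attains`. Integrability of the running cost is passed along because
splitting the integral at `τ` requires it. -/
theorem cost_cons {u : ImpulseControl K τ T} {ht : t ≤ τ} {hτ : τ ≤ T} {hξ : ξ ∈ K}
    (hX : IsTrajectory f x (u.cons ht hτ hξ) X) (hX' : IsTrajectory f (Φ t τ x + ξ) u X')
    (heq : ∀ s, τ ≤ s → X s = X' s) (hΦ : IsDriftFlow T f Φ) (ht0 : 0 ≤ t)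
    (hg : Continuous fun p : ℝ × State n => g p.1 p.2)
    (hint : IntervalIntegrable (fun s => g s (X' s)) volume τ T) :
    IntervalIntegrable (fun s => g s (X s)) volume t T ∧
      cost g h l (u.cons ht hτ hξ) X =
        runCost Φ g t τ x + l τ (Φ t τ x) ξ + cost g h l u X' := by
  have hflow := (hX.eq_flow hΦ ht0 ht hτ (u.le_time_cons ht hτ hξ)).1
  have hint1 : IntervalIntegrable (fun s => g s (X s)) volume t τ := by
    refine ((continuous_running hΦ.toIsFlow hg t x).intervalIntegrable t τ).congr_uIoo
      fun r hr => ?_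
    rw [uIoo_of_le ht] at hr
    simp only [hflow r ⟨hr.1.le, hr.2⟩]
  have hint2 : IntervalIntegrable (fun s => g s (X s)) volume τ T := hint.congr fun r hr => by
    rw [uIoc_of_le hτ] at hr
    simp only [heq r hr.1.le]
  have e1 : ∫ s in t..τ, g s (X s) = runCost Φ g t τ x :=
    intervalIntegral.integral_congr_Ioo_of_le ht fun r hr => by
      simp only [hflow r ⟨hr.1.le, hr.2⟩]
  have e2 : ∫ s in τ..T, g s (X s) = ∫ s in τ..T, g s (X' s) :=
    intervalIntegral.integral_congr fun r hr => by
      rw [uIcc_of_le hτ] at hr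
      simp only [heq r hr.1]
  have e3 : stateBefore (u.cons ht hτ hξ) X (0 : Fin (u.N + 1)) = Φ t τ x := by
    refine (add_eq_left.2 (Finset.sum_eq_zero fun j hj => ?_)).trans ?_
    · exact absurd (Finset.mem_filter.1 hj).2.1 (Nat.not_lt_zero j.val)
    exact hX.leftLim_eq hΦ ht0 ht hτ (u.le_time_cons ht hτ hξ)
  have e4 : ∑ k, l ((u.cons ht hτ hξ).time k) (stateBefore (u.cons ht hτ hξ) X k)
      ((u.cons ht hτ hξ).impulse k) =
      l τ (Φ t τ x) ξ + ∑ k, l (u.time k) (stateBefore u X' k) (u.impulse k) := by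
    refine (Fin.sum_univ_succ (n := u.N) _).trans ?_
    rw [e3]
    refine congrArg _ (Finset.sum_congr rfl fun k _ => ?_)
    rw [stateBefore_cons_succ hX hX' heq hΦ ht0]
    rfl
  refine ⟨hint1.trans hint2, ?_⟩
  rw [cost, cost, e4, ← intervalIntegral.integral_add_adjacent_intervals hint1 hint2, e1, e2,
    heq T hτ]
  ring

/-- Split off the first impulse and induct on their number; the initial data are quantified inside,
since the tail starts later and from another state. -/
theorem IsTrajectory.attains {B : Set (State n)} (hΦ : IsDriftFlow T f Φ)
    (hg : Continuous fun p : ℝ × State n => g p.1 p.2) (N : ℕ) :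
    ∀ {t : ℝ} {x : State n} {u : ImpulseControl K t T} {X : ℝ → State n}, u.N = N → 0 ≤ t →
      t ≤ T → IsTrajectory f x u X → X T ∈ B →
      IntervalIntegrable (fun s => g s (X s)) volume t T ∧
        Attains Φ g h l (K : Set (State n)) T B N t x (cost g h l u X) := by
  induction N with
  | zero =>
    intro t x u X hN ht0 htT hX hB
    have : IsEmpty (Fin u.N) := by rw [hN]; infer_instance
    obtain ⟨h1, h2⟩ := hX.eq_flow hΦ ht0 htT le_rfl (fun k => isEmptyElim k)
    have hT : X T = Φ t T x := by
      rw [hX.eqn T ⟨htT, le_rfl⟩, h2, u.path_eq_zero fun k => isEmptyElim k, add_zero]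
    have e1 : ∫ s in t..T, g s (X s) = runCost Φ g t T x :=
      intervalIntegral.integral_congr_Ioo_of_le htT fun r hr => by
        simp only [h1 r ⟨hr.1.le, hr.2⟩]
    constructor
    · refine ((continuous_running hΦ.toIsFlow hg t x).intervalIntegrable t T).congr_uIoo
        fun r hr => ?_
      rw [uIoo_of_le htT] at hr
      simp only [h1 r ⟨hr.1.le, hr.2⟩]
    · rw [cost, e1, Finset.univ_eq_empty, Finset.sum_empty, add_zero, hT]
      rw [hT] at hB
      exact .coast htT hB
  | succ N ih =>
    intro t x u X hN ht0 htT hX hB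
    obtain ⟨τ, ξ, ht, hτ, hξ, u', hN', rfl⟩ := u.exists_eq_cons hN
    have hX' := hX.tail hΦ ht0
    have heq : ∀ s, τ ≤ s → X s = if s < τ then Φ t τ x + ξ else X s :=
      fun s hs => (if_neg (not_lt.2 hs)).symm
    obtain ⟨h1, h2⟩ := ih hN' (ht0.trans ht) hτ hX' (by rwa [← heq T hτ])
    obtain ⟨h3, h4⟩ := cost_cons (h := h) (l := l) hX hX' heq hΦ ht0 hg h1
    exact ⟨h3, h4 ▸ .jump ht hξ h2⟩

theorem Attains.exists_isTrajectory {B : Set (State n)} {N : ℕ} {c : ℝ}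
    (hΦ : IsDriftFlow T f Φ) (hg : Continuous fun p : ℝ × State n => g p.1 p.2)
    (ha : Attains Φ g h l (K : Set (State n)) T B N t x c) (ht0 : 0 ≤ t) :
    ∃ (u : ImpulseControl K t T) (X : ℝ → State n), IsTrajectory f x u X ∧ X T ∈ B ∧
      IntervalIntegrable (fun s => g s (X s)) volume t T ∧ cost g h l u X = c := by
  induction ha with
  | @coast t x htT hend =>
    have htI : t ∈ Icc 0 T := ⟨ht0, htT⟩
    set X : ℝ → State n := fun s => if s < t then x else Φ t s x
    have hge : ∀ s, t ≤ s → X s = Φ t s x := fun s hs => if_neg (not_lt.2 hs)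
    let u : ImpulseControl K t T := ⟨0, Fin.elim0, Fin.elim0, fun i => i.elim0, fun i => i.elim0,
      fun i => i.elim0⟩
    refine ⟨u, X, ⟨fun s hs => if_pos hs, ?_, fun s hs => ?_⟩, by rwa [hge T htT], ?_, ?_⟩
    · have h1 : IntervalIntegrable (fun r => f r (Φ t r x)) volume t T :=
        ((hΦ.continuous_drift t x).mono
          (uIcc_subset_Icc htI ⟨ht0.trans htT, le_rfl⟩)).intervalIntegrable
      refine h1.congr fun r hr => ?_
      rw [uIoc_of_le htT] at hr
      simp only [hge r hr.1.le]
    · rw [hge s hs.1, u.path_eq_zero (fun k => k.elim0), add_zero,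
        ← hΦ.integral_eq htI ⟨ht0.trans hs.1, hs.2⟩ x]
      refine congrArg (x + ·) (intervalIntegral.integral_congr fun r hr => ?_)
      rw [uIcc_of_le hs.1] at hr
      simp only [hge r hr.1]
    · refine ((continuous_running hΦ.toIsFlow hg t x).intervalIntegrable t T).congr fun r hr => ?_
      rw [uIoc_of_le htT] at hr
      simp only [hge r hr.1.le]
    · have e : ∫ s in t..T, g s (X s) = runCost Φ g t T x :=
        intervalIntegral.integral_congr fun r hr => by
          rw [uIcc_of_le htT] at hr
          simp only [hge r hr.1]
      rw [cost, e, hge T htT]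
      exact add_zero _
  | @jump N t τ x ξ c ht hξ hc ih =>
    obtain ⟨u, X', hX', hB, hint, hcost⟩ := ih (ht0.trans ht)
    obtain ⟨X, hX, heq⟩ := hX'.exists_cons ht hc.le hξ hΦ ht0
    obtain ⟨h3, h4⟩ := cost_cons (h := h) (l := l) hX hX' heq hΦ ht0 hg hint
    exact ⟨_, X, hX, by rwa [heq T hc.le], h3, by rw [h4, hcost]⟩

end Trajectory

/-! ### From the hypotheses to the abstract control data. -/

section Main

variable {n : ℕ} {K : ProperCone ℝ (State n)} {D : Set (State n)}
  {T L μ δ l0 δ0 β : ℝ} {α0 α : ℝ → ℝ}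
  {f : ℝ → State n → State n} {g : ℝ → State n → ℝ} {h : State n → ℝ}
  {l : ℝ → State n → State n → ℝ}

theorem DriftHyp.exists_isDriftFlow (hf : DriftHyp T L f) (hT : 0 < T) (hL : 0 < L) :
    ∃ Φ, IsDriftFlow T f Φ := by
  have hlip : ∀ r ∈ Icc 0 T, LipschitzWith L.toNNReal (f r) := fun r hr =>
    LipschitzWith.of_dist_le_mul fun x y => by
      rw [Real.coe_toNNReal _ hL.le, dist_eq_norm, dist_eq_norm]
      exact hf.lipschitz r hr x y
  have hc : ∀ x, ContinuousOn (fun r => f r x) (Icc 0 T) := fun x =>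
    hf.continuousOn.comp (f := fun r => (r, x)) (by fun_prop) fun r hr => ⟨hr, mem_univ _⟩
  obtain ⟨Φ, hΦ, hcurve⟩ := exists_isFlow hT hL hlip hc hf.bound_zero
  exact ⟨Φ, hΦ, hcurve, ⟨_, hlip⟩, hf.continuousOn⟩

/-- A running cost on `[0, T]` extends to a continuous non-negative one for all times. -/
theorem CostHyp.exists_extension (hgh : CostHyp T L μ δ g h) (hT : 0 < T) :
    ∃ g' : ℝ → State n → ℝ, (Continuous fun p : ℝ × State n => g' p.1 p.2) ∧
      (∀ t x, 0 ≤ g' t x) ∧ ∀ t ∈ Icc 0 T, g' t = g t := by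
  refine ⟨fun t x => g (projIcc 0 T hT.le t) x, ?_, fun t x => hgh.g_nonneg _ (Subtype.prop _) x,
    fun t ht => by simp only [projIcc_of_mem hT.le ht]⟩
  have hP : Continuous (projIcc 0 T hT.le) := continuous_projIcc
  exact hgh.continuousOn_g.comp_continuous
    (f := fun p : ℝ × State n => ((projIcc 0 T hT.le p.1 : ℝ), p.2))
    ((continuous_subtype_val.comp (hP.comp continuous_fst)).prodMk continuous_snd)
    fun p => ⟨Subtype.prop _, mem_univ _⟩

theorem ImpulseCostHyp.exists_extension (hl : ImpulseCostHyp K T L μ δ l0 δ0 β α0 α l) :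
    ∃ l' : ℝ → State n → State n → ℝ,
      (Continuous fun p : ℝ × State n × State n => l' p.1 p.2.1 p.2.2) ∧
      ∀ t ∈ Icc 0 T, ∀ x, ∀ ξ ∈ K, l' t x ξ = l t x ξ := by
  have hcl : IsClosed (Icc 0 T ×ˢ ((univ : Set (State n)) ×ˢ (K : Set (State n)))) :=
    isClosed_Icc.prod (isClosed_univ.prod K.isClosed)
  -- Tietze extension. Bounds for the extension are not needed: `ControlData` bounds impulse costs
  -- only for times in `[0, T]` and impulses in `K`.
  obtain ⟨F, hF⟩ := ContinuousMap.exists_restrict_eq hcl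
    ⟨_, continuousOn_iff_continuous_domRestrict.1 hl.continuousOn⟩
  refine ⟨fun t x ξ => F (t, x, ξ), F.continuous, fun t ht x ξ hξ => ?_⟩
  exact DFunLike.congr_fun hF ⟨(t, x, ξ), ht, mem_univ _, hξ⟩

/-- `α0` is smallest at `T`, and positive there, so a single radius serves for all times. -/
theorem ImpulseCostHyp.coercive (hl : ImpulseCostHyp K T L μ δ l0 δ0 β α0 α l) (hT : 0 < T)
    (C : ℝ) : ∃ R, ∀ t ∈ Icc 0 T, ∀ x, ∀ ξ ∈ K, l t x ξ ≤ C → ‖ξ‖ ≤ R := by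
  have hTI : T ∈ Icc 0 T := ⟨hT.le, le_rfl⟩
  have ha := hl.α0_pos T hTI
  refine ⟨(C / α0 T) ^ β⁻¹, fun t ht x ξ hξ hle => ?_⟩
  have h1 := hl.lower t ht x ξ hξ
  have h2 := hl.α0_antitoneOn ht hTI ht.2
  have h3 : (0 : ℝ) ≤ ‖ξ‖ ^ β := by positivity
  have h4 : ‖ξ‖ ^ β ≤ C / α0 T := by
    rw [le_div_iff₀ ha]
    nlinarith [hl.l0_pos]
  calc ‖ξ‖ = (‖ξ‖ ^ β) ^ β⁻¹ := (Real.rpow_rpow_inv (norm_nonneg _) hl.β_pos.ne').symm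
    _ ≤ (C / α0 T) ^ β⁻¹ := Real.rpow_le_rpow h3 h4 (inv_nonneg.2 hl.β_pos.le)

theorem TargetHyp.exists_add_mem (hD : TargetHyp K D) (y : State n) : ∃ ξ ∈ K, y + ξ ∈ D := by
  rcases hD.bounded_or_conic with ⟨-, hK⟩ | ⟨-, hK⟩
  · obtain ⟨d, hd⟩ := hD.isConnected.nonempty
    have hmem : d - y ∈ (K : Set (State n)) := hK ▸ mem_univ _
    exact ⟨d - y, hmem, by simpa using hd⟩
  · obtain ⟨d, hd, k, hk, rfl⟩ : y ∈ D - (K : Set (State n)) := hK ▸ mem_univ y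
    exact ⟨k, hk, by simpa using hd⟩

theorem cost_congr {t : ℝ} {u : ImpulseControl K t T} {X : ℝ → State n} {g' : ℝ → State n → ℝ}
    {l' : ℝ → State n → State n → ℝ} (ht : t ∈ Icc 0 T) (hg : ∀ t ∈ Icc 0 T, g' t = g t)
    (hl : ∀ t ∈ Icc 0 T, ∀ x, ∀ ξ ∈ K, l' t x ξ = l t x ξ) :
    cost g' h l' u X = cost g h l u X := by
  have e1 : ∫ s in t..T, g' s (X s) = ∫ s in t..T, g s (X s) :=
    intervalIntegral.integral_congr fun r hr => by
      rw [uIcc_of_le ht.2] at hr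
      simp only [hg r ⟨ht.1.trans hr.1, hr.2⟩]
  rw [cost, cost, e1]
  refine congrArg _ (Finset.sum_congr rfl fun k _ => ?_)
  exact hl _ ⟨ht.1.trans (u.time_mem k).1, (u.time_mem k).2⟩ _ _ (u.impulse_mem k)

/-- The value function is the least attainable cost. -/
theorem value_eq_of_isLeast {Φ : ℝ → ℝ → State n → State n} {t : ℝ} {x : State n}
    {g' : ℝ → State n → ℝ} {l' : ℝ → State n → State n → ℝ} (hΦ : IsDriftFlow T f Φ)
    (hgc : Continuous fun p : ℝ × State n => g' p.1 p.2) (ht : t ∈ Icc 0 T)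
    (hg : ∀ t ∈ Icc 0 T, g' t = g t) (hl : ∀ t ∈ Icc 0 T, ∀ x, ∀ ξ ∈ K, l' t x ξ = l t x ξ)
    {v : ℝ} (hv : IsLeast {c | ∃ N, Attains Φ g' h l' (K : Set (State n)) T (closure D) N t x c} v) :
    value K D T f g h l t x = v := by
  apply le_antisymm
  · obtain ⟨N, hN⟩ := hv.1
    obtain ⟨u, X, hX, hXT, -, hcost⟩ := hN.exists_isTrajectory hΦ hgc ht.1
    rw [cost_congr ht hg hl] at hcost
    exact hcost ▸ iInf_le_of_le u (iInf_le_of_le X (iInf₂_le hX hXT))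
  · refine le_iInf fun u => le_iInf fun X => le_iInf₂ fun hX hXT => ?_
    have h1 := (hX.attains (h := h) (l := l') hΦ hgc u.N rfl ht.1 ht.2 hXT).2
    rw [cost_congr ht hg hl] at h1
    exact EReal.coe_le_coe_iff.2 (hv.2 ⟨_, h1⟩)

end Main

end ImpulseQVI

/-! ### The main theorem. -/

theorem mainTheorem2 {n : ℕ} (K : ProperCone ℝ (State n)) (D : Set (State n))
    (T L μ δ l0 δ0 β : ℝ) (α0 α : ℝ → ℝ)
    (f : ℝ → State n → State n) (g : ℝ → State n → ℝ) (h : State n → ℝ)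
    (l : ℝ → State n → State n → ℝ)
    (hT : 0 < T) (hL : 0 < L) (hμ : 0 < μ) (hδ : 0 < δ) (hδ_le : δ ≤ 1)
    (hD : TargetHyp K D) (hf : DriftHyp T L f) (hgh : CostHyp T L μ δ g h)
    (hl : ImpulseCostHyp K T L μ δ l0 δ0 β α0 α l) (hcompat : Compatible K D T h l) :
    -- the value function is finite on `[0, T] × ℝⁿ`
    (∀ t ∈ Set.Icc 0 T, ∀ x, value K D T f g h l t x ≠ ⊤ ∧ value K D T f g h l t x ≠ ⊥) ∧
    -- the minima that define `N[V]` and `N^D[h]` are attained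
    (∀ t ∈ Set.Icc 0 T, ∀ x, ∃ ξ ∈ K,
      obstacle K l (fun s y => (value K D T f g h l s y).toReal) t x =
        (((value K D T f g h l t (x + ξ)).toReal + l t x ξ : ℝ) : EReal)) ∧
    (∀ x, ∃ ξ ∈ K, x + ξ ∈ closure D ∧
      terminalObstacle K D T h l x = ((h (x + ξ) + l T x ξ : ℝ) : EReal)) ∧
    -- the value function is a (continuous) viscosity solution
    IsViscositySolution K D T f g h l (fun t x => (value K D T f g h l t x).toReal) := by
  have hTI : T ∈ Icc 0 T := ⟨hT.le, le_rfl⟩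
  obtain ⟨Φ, hΦ⟩ := hf.exists_isDriftFlow hT hL
  obtain ⟨g', hgc, hg0, hgeq⟩ := hgh.exists_extension hT
  obtain ⟨l', hlc, hleq⟩ := hl.exists_extension
  have H : ControlData Φ g' h l' (K : Set (State n)) T l0 :=
    { isFlow := hΦ.toIsFlow
      continuous_g := hgc
      continuous_h := hgh.continuous_h
      continuous_l := hlc
      g_nonneg := hg0
      h_nonneg := hgh.h_nonneg
      isClosed := K.isClosed
      l0_pos := hl.l0_pos
      l0_le := fun t ht x ξ hξ => by
        rw [hleq t ht x ξ hξ]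
        have h1 := hl.lower t ht x ξ hξ
        have h2 := hl.α0_pos t ht
        have h3 : 0 ≤ α0 t * ‖ξ‖ ^ β := by positivity
        linarith
      coercive := fun C => by
        obtain ⟨R, hR⟩ := hl.coercive hT C
        exact ⟨R, fun t ht x ξ hξ hle => hR t ht x ξ hξ (by rwa [← hleq t ht x ξ hξ])⟩ }
  have hjump : ∀ y, ∃ ξ ∈ (K : Set (State n)), y + ξ ∈ closure D := fun y => by
    obtain ⟨ξ, hξ, hmem⟩ := hD.exists_add_mem y
    exact ⟨ξ, hξ, subset_closure hmem⟩
  have hcompat' : ∀ y ∉ D, ∃ ξ ∈ (K : Set (State n)),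
      y + ξ ∈ D ∧ h (y + ξ) + l' T y ξ ≤ h y := fun y hy => by
    -- Since the infimum is strictly below `h y`, some actual impulse does at least as well as
    -- staying.
    obtain ⟨ξ, hξ⟩ := iInf_lt_iff.1 (hcompat y hy)
    obtain ⟨hξK, hξ⟩ := iInf_lt_iff.1 hξ
    obtain ⟨hξD, hξ⟩ := iInf_lt_iff.1 hξ
    exact ⟨ξ, hξK, hξD, by rw [hleq T hTI y ξ hξK]; exact (EReal.coe_lt_coe_iff.1 hξ).le⟩
  set V : ℝ → State n → ℝ := fun t x => (value K D T f g h l t x).toReal with hVdef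
  have hV' : ∀ t ∈ Icc 0 T, ∀ x, value K D T f g h l t x = V t x ∧
      IsLeast {c | ∃ N, Attains Φ g' h l' (K : Set (State n)) T (closure D) N t x c} (V t x) := by
    intro t ht x
    obtain ⟨v, hv⟩ := exists_isLeast_attains H isClosed_closure ht hjump x
    have he := value_eq_of_isLeast hΦ hgc ht hgeq hleq hv
    have hVv : V t x = v := by simp only [hVdef, he, EReal.toReal_coe]
    rw [hVv]
    exact ⟨he, hv⟩
  have hV := fun t ht x => (hV' t ht x).2
  have hV0 : ∀ t ∈ Icc 0 T, ∀ x, 0 ≤ V t x := fun t ht x => by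
    obtain ⟨N, hN⟩ := (hV t ht x).1
    exact hN.nonneg H ht.1
  have hcont : ContinuousOn (fun p : ℝ × State n => V p.1 p.2) (strip n T) :=
    continuousOn_value H hD.isOpen hcompat' hV
  have hobs : ∀ t ∈ Icc 0 T, ∀ x, ∃ ξ ∈ K,
      obstacle K l V t x = ((V t (x + ξ) + l t x ξ : ℝ) : EReal) := by
    intro t ht x
    have hVt : Continuous fun ξ => V t (x + ξ) :=
      hcont.comp_continuous (f := fun ξ => (t, x + ξ)) (by fun_prop) fun ξ => ⟨ht, mem_univ _⟩
    have hF : Continuous fun ξ => V t (x + ξ) + l' t x ξ :=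
      hVt.add (hlc.comp (by fun_prop : Continuous fun ξ => (t, x, ξ)))
    obtain ⟨ξ, hξ, hmin⟩ := exists_forall_le_of_coercive H ht (x := x) hF H.isClosed Subset.rfl
      ⟨0, K.zero_mem⟩ fun ξ _ => le_add_of_nonneg_left (hV0 t ht _)
    refine ⟨ξ, hξ, le_antisymm (iInf₂_le ξ hξ) (le_iInf₂ fun ξ' hξ' => ?_)⟩
    rw [← hleq t ht x ξ hξ, ← hleq t ht x ξ' hξ']
    exact EReal.coe_le_coe_iff.2 (hmin ξ' hξ')
  have hterm : ∀ x, ∃ ξ ∈ K, x + ξ ∈ closure D ∧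
      terminalObstacle K D T h l x = ((h (x + ξ) + l T x ξ : ℝ) : EReal) := by
    intro x
    have hF : Continuous fun ξ => h (x + ξ) + l' T x ξ :=
      (hgh.continuous_h.comp (by fun_prop)).add
        (hlc.comp (by fun_prop : Continuous fun ξ => (T, x, ξ)))
    have hS : IsClosed ((K : Set (State n)) ∩ (fun ξ => x + ξ) ⁻¹' closure D) :=
      H.isClosed.inter (isClosed_closure.preimage (by fun_prop))
    obtain ⟨ξ, hξ, hmin⟩ := exists_forall_le_of_coercive H hTI (x := x) hF hS inter_subset_left
      (hjump x) fun ξ _ => le_add_of_nonneg_left (hgh.h_nonneg _)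
    refine ⟨ξ, hξ.1, hξ.2, le_antisymm (iInf_le_of_le ξ (iInf₂_le hξ.1 hξ.2))
      (le_iInf fun ξ' => le_iInf₂ fun hξ' hmem => ?_)⟩
    rw [← hleq T hTI x ξ hξ.1, ← hleq T hTI x ξ' hξ']
    exact EReal.coe_le_coe_iff.2 (hmin ξ' ⟨hξ', hmem⟩)
  have hstay : ∀ x ∈ closure D, V T x ≤ h x := fun x hx => by
    have ha : Attains Φ g' h l' (K : Set (State n)) T (closure D) 0 T x _ :=
      .coast le_rfl (by rwa [H.isFlow.self])
    rw [runCost_self, H.isFlow.self, zero_add] at ha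
    exact (hV T hTI x).2 ⟨0, ha⟩
  have hmove : ∀ x, ∀ ξ ∈ K, x + ξ ∈ closure D → V T x ≤ h (x + ξ) + l T x ξ :=
    fun x ξ hξ hmem => by
      have h1 := value_le_jump H hV hTI (x := x) hξ
      rw [hleq T hTI x ξ hξ] at h1
      linarith [hstay _ hmem]
  have hterminal : ∀ x, terminalValue K D T h l x = V T x := by
    intro x
    have hle : (V T x : EReal) ≤ terminalObstacle K D T h l x :=
      le_iInf fun ξ => le_iInf₂ fun hξ hmem => EReal.coe_le_coe_iff.2 (hmove x ξ hξ hmem)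
    obtain ⟨N, hN⟩ := (hV T hTI x).1
    -- An optimal control at time `T` reduces to at most one impulse; `δ0 > 0` makes the impulse
    -- cost subadditive.
    have hcases := hN.terminal H (fun ξ hξ ξ' hξ' => K.add_mem hξ hξ') (fun y ξ hξ ξ' hξ' => by
      rw [hleq T hTI _ _ (K.add_mem hξ hξ'), hleq T hTI _ _ hξ, hleq T hTI _ _ hξ']
      have h1 := hl.subadditive T hTI y ξ hξ ξ' hξ'
      have h2 := min_le_left (l T y ξ + l T (y + ξ) ξ') (l T y ξ' + l T (y + ξ') ξ)
      linarith [hl.δ0_pos]) rfl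
    have hge : ∀ ξ ∈ (K : Set (State n)), x + ξ ∈ closure D → h (x + ξ) + l' T x ξ ≤ V T x →
        terminalObstacle K D T h l x ≤ V T x := fun ξ hξ hmem hle' => by
      rw [hleq T hTI x ξ hξ] at hle'
      exact (iInf_le_of_le ξ (iInf₂_le hξ hmem)).trans (EReal.coe_le_coe_iff.2 hle')
    unfold terminalValue
    split_ifs with hx
    · refine le_antisymm ?_ (le_min (EReal.coe_le_coe_iff.2 (hstay x hx)) hle)
      rcases hcases with ⟨-, h1⟩ | ⟨ξ, hξ, hmem, h1⟩
      · exact (min_le_left _ _).trans (EReal.coe_le_coe_iff.2 h1)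
      · exact (min_le_right _ _).trans (hge ξ hξ hmem h1)
    · refine le_antisymm ?_ hle
      rcases hcases with ⟨h1, -⟩ | ⟨ξ, hξ, hmem, h1⟩
      · exact absurd h1 hx
      · exact hge ξ hξ hmem h1
  have hham : ∀ φ, ∀ t ∈ Icc 0 T, ∀ x, hamiltonian T f g' φ t x = hamiltonian T f g φ t x :=
    fun φ t ht x => by simp only [hamiltonian, hgeq t ht]
  refine ⟨fun t ht x => ?_, hobs, hterm, ⟨hcont, fun x => (hterminal x).le, ?_⟩,
    ⟨hcont, fun x => (hterminal x).ge, ?_⟩⟩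
  · rw [(hV' t ht x).1]
    exact ⟨EReal.coe_ne_top _, EReal.coe_ne_bot _⟩
  · intro φ hφ t ht x hmin
    have ht' := Ico_subset_Icc_self ht
    -- Either an immediate impulse is optimal and the obstacle term is at most zero, or every
    -- immediate impulse is strictly worse, an optimal control coasts, and the Hamiltonian term is
    -- at most zero.
    by_cases hex : ∃ ξ ∈ K, V t (x + ξ) + l t x ξ ≤ V t x
    · obtain ⟨ξ, hξ, hle⟩ := hex
      refine (min_le_right _ _).trans (EReal.sub_nonpos.2 ?_)
      exact (iInf₂_le ξ hξ).trans (EReal.coe_le_coe_iff.2 hle)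
    · push Not at hex
      obtain ⟨s, hs, -, hr⟩ := coast_le_value H hV ht fun ξ hξ => by
        rw [hleq t ht' x ξ hξ]; exact hex ξ hξ
      refine (min_le_left _ _).trans ?_
      rw [← hham φ t ht' x, EReal.coe_nonpos]
      refine hamiltonian_nonpos_of_isLocalMinOn H.isFlow hΦ.curve hgc ht hφ hmin ?_
      filter_upwards [Icc_mem_nhdsGT hs] with r hr' using hr r hr'
  · intro φ hφ t ht x hmax
    have ht' := Ico_subset_Icc_self ht
    refine le_min ?_ ?_
    · rw [← hham φ t ht' x, EReal.coe_nonneg]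
      refine hamiltonian_nonneg_of_isLocalMaxOn H.isFlow hΦ.curve hgc ht hφ hmax ?_
      filter_upwards [Icc_mem_nhdsGT ht.2] with r hr using value_le_coast H hV ht' hr.1 hr.2
    · obtain ⟨ξ, hξ, he⟩ := hobs t ht' x
      have h1 := value_le_jump H hV ht' (x := x) hξ
      rw [hleq t ht' x ξ hξ] at h1
      rw [he, ← EReal.coe_sub, EReal.coe_nonneg]
      exact sub_nonneg.2 h1
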